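/- Let $\mathcal M$ be a smooth $4$-manifold with a smooth metric $g$ of signature $(-1,1,1,1)$, and let $\mathcal F$ be a null foliation of $\mathcal M$, i.e. a foliation by $2$-dimensional submanifolds such that $g$ restricted to every tangent plane $T_x\mathcal F$ of a leaf is degenerate. Let $(U,(x^1,x^2,x^3,x^4))$ be a null foliation adapted chart (a smooth chart such that $T_x\mathcal F=\ker dx^3\cap\ker dx^4$ for all $x\in U$). Let $(s,l,\alpha^\sharp,n)$ be a null foliation adapted frame on $U$: smooth vector fields such that $l,s$ span $T\mathcal F$, $g(l,l)=g(n,n)=0$, $g(n,l)=-1$, $g(s,s)=g(\alpha^\sharp,\alpha^\sharp)=1$, and all other scalar products among $s,l,\alpha^\sharp,n$ vanish; put $\alpha=g(\alpha^\sharp,\cdot)$, $l^\flat=g(l,\cdot)$, $s^\flat=g(s,\cdot)$. In the chart put $$M^r=g^{r3}g^{34}-g^{33}g^{r4},\qquad N^r=g^{r3}g^{44}-g^{34}g^{r4},\qquad \nabla_rV^r=\frac1{\sqrt{-g}}\,\partial_r\!\left(\sqrt{-g}\,V^r\right),$$ and let $\kappa=(\alpha_3 l^\flat_4-\alpha_4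 l^\flat_3)^{-1}$. Let $\nabla$ be the Levi-Civita connection of $g$, and $\theta=\tfrac12\,[\,g(\nabla_s l,s)+g(\nabla_{\alpha^\sharp}l,\alpha^\sharp)\,]$. A $2$-form $F$ on $U$ is a null force-free field if $dF=0$, $i_{j^\sharp}F=0$ with $j=*\,d*F$, and $F_{\mu\nu}F^{\mu\nu}=0$. Call a smooth function $u$ on $U$ admissible if it has no zeros and depends only on $x^3,x^4$, in the sense that $\partial_1u=\partial_2u=0$. Then the following are equivalent (so the three characterizations of the existence of null force-free fields, by the conditions 1, 2 and 3, are equivalent): 1. $\nabla_rM^r=0=\nabla_rN^r$ on $U$; 2. $d\alpha(l,\alpha^\sharp)=ds^\flat(l,s)$ and $dl^\flat(l,\alpha^\sharp)=0$ on $U$; 3. $l$ is pregeodesic on $U$ (i.e. $\nabla_l l$ is a multiple of $l$ at every point), and $\mathcal F$ admits an equipartition of null mean curvature with respect to $l$, i.e. $\theta=g(\nabla_s l,s)$ on $U$; 4. the null force-free fields $F$ on $U$ with $\ker F=T\mathcal F$ are exactly the $2$-forms $F=u\,dx^3\wedge dx^4$ with $u$ admissible; 5. the null force-free fields $F$ on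 $U$ with $\ker F=T\mathcal F$ are exactly the $2$-forms $F=(u\kappa)\,\alpha\wedge l^\flat$ with $u$ admissible. -/

import Mathlib

open scoped Manifold ContDiff Bundle

noncomputable section

namespace NullFFE

/-- The model space of a spacetime. Coordinates `x¹, x², x³, x⁴` have indices `0, 1, 2, 3`. -/
abbrev E4 : Type := EuclideanSpace ℝ (Fin 4)

section Fields

variable (M : Type*) [TopologicalSpace M] [ChartedSpace E4 M]

/-- Vector fields (no regularity yet). -/
abbrev VField : Type _ := ∀ x : M, TangentSpace 𝓘(ℝ, E4) x

/-- Covariant 2-tensor fields (no regularity yet). -/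
abbrev Tensor2 : Type _ :=
  ∀ x : M, TangentSpace 𝓘(ℝ, E4) x →L[ℝ] TangentSpace 𝓘(ℝ, E4) x →L[ℝ] ℝ

/-- Fields of tangent subspaces. -/
abbrev PlaneField : Type _ := ∀ x : M, Submodule ℝ (TangentSpace 𝓘(ℝ, E4) x)

end Fields

variable {M : Type*} [TopologicalSpace M] [ChartedSpace E4 M]

/-- `X` is a smooth vector field on `U`. -/
def SmoothVFieldOn [IsManifold 𝓘(ℝ, E4) ∞ M] (X : VField M) (U : Set M) : Prop :=
  ContMDiffOn 𝓘(ℝ, E4) (𝓘(ℝ, E4).prod 𝓘(ℝ, E4)) ∞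
    (fun x => Bundle.TotalSpace.mk' E4 x (X x) :
      M → Bundle.TotalSpace E4 (fun x : M => TangentSpace 𝓘(ℝ, E4) x)) U

/-- `T` is a smooth covariant 2-tensor field on `U`. -/
def SmoothTensor2On [IsManifold 𝓘(ℝ, E4) ∞ M] (T : Tensor2 M) (U : Set M) : Prop :=
  ContMDiffOn 𝓘(ℝ, E4) (𝓘(ℝ, E4).prod 𝓘(ℝ, E4 →L[ℝ] E4 →L[ℝ] ℝ)) ∞
    (fun x => Bundle.TotalSpace.mk' (E4 →L[ℝ] E4 →L[ℝ] ℝ) x (T x) :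
      M → Bundle.TotalSpace (E4 →L[ℝ] E4 →L[ℝ] ℝ)
        (fun x : M => TangentSpace 𝓘(ℝ, E4) x →L[ℝ] TangentSpace 𝓘(ℝ, E4) x →L[ℝ] ℝ)) U

/-- `u` is a smooth real function on `U`. -/
def SmoothFunOn (u : M → ℝ) (U : Set M) : Prop :=
  ContMDiffOn 𝓘(ℝ, E4) 𝓘(ℝ, ℝ) ∞ u U

/-- A smooth metric of signature `(-1, 1, 1, 1)`: every tangent space has an orthonormal basis
with one timelike and three spacelike vectors. -/
structure IsLorentzMetric [IsManifold 𝓘(ℝ, E4) ∞ M] (g : Tensor2 M) : Prop where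
  smooth : SmoothTensor2On g Set.univ
  signature : ∀ x : M, ∃ b : Module.Basis (Fin 4) ℝ (TangentSpace 𝓘(ℝ, E4) x),
    ∀ i j, g x (b i) (b j) = if i = j then (if i = 0 then -1 else 1) else 0

/-! ### Charts and components -/

/-- `φ` is a smooth coordinate chart of `M`. -/
def IsChart (φ : OpenPartialHomeomorph M E4) : Prop :=
  φ ∈ IsManifold.maximalAtlas 𝓘(ℝ, E4) ∞ M

/-- `dxⁱ(v)`, the `i`-th component of the tangent vector `v` in the chart `φ`. -/
def dx (φ : OpenPartialHomeomorph M E4) (i : Fin 4) (x : M) (v : TangentSpace 𝓘(ℝ, E4) x) : ℝ :=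
  mvfderiv 𝓘(ℝ, E4) φ x v i

/-- The coordinate vector field `∂ᵢ` of the chart `φ` (on the domain of `φ`). -/
def coordVec (φ : OpenPartialHomeomorph M E4) (i : Fin 4) : VField M :=
  VectorField.mpullback 𝓘(ℝ, E4) 𝓘(ℝ, E4) φ
    (fun y => (NormedSpace.fromTangentSpace y).symm (EuclideanSpace.single i (1 : ℝ)))

/-- The derivative `X(f)` of the function `f` along the vector field `X`. -/
def dirDeriv (X : VField M) (f : M → ℝ) (x : M) : ℝ :=
  mvfderiv 𝓘(ℝ, E4) f x (X x)

/-- The partial derivative `∂ᵢ f` in the chart `φ`. -/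
def pd (φ : OpenPartialHomeomorph M E4) (i : Fin 4) (f : M → ℝ) (x : M) : ℝ :=
  dirDeriv (coordVec φ i) f x

/-- The component `Tᵢⱼ = T(∂ᵢ, ∂ⱼ)`. -/
def comp2 (φ : OpenPartialHomeomorph M E4) (T : Tensor2 M) (i j : Fin 4) (x : M) : ℝ :=
  T x (coordVec φ i x) (coordVec φ j x)

/-- The matrix `gᵢⱼ` of the metric in the chart. -/
def gram (φ : OpenPartialHomeomorph M E4) (g : Tensor2 M) (x : M) : Matrix (Fin 4) (Fin 4) ℝ :=
  Matrix.of fun i j => comp2 φ g i j x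

/-- The inverse metric `gⁱʲ` in the chart. -/
def ginv (φ : OpenPartialHomeomorph M E4) (g : Tensor2 M) (i j : Fin 4) (x : M) : ℝ :=
  (gram φ g x)⁻¹ i j

/-- `√(-g)`, with `g` the determinant of the matrix of the metric. -/
def sqrtNegDet (φ : OpenPartialHomeomorph M E4) (g : Tensor2 M) (x : M) : ℝ :=
  Real.sqrt (-(gram φ g x).det)

/-! ### Hodge duals and the force-free equations -/

/-- The alternating symbol `ε` on four indices, with `ε 0 1 2 3 = 1`. -/
def eps (a b c d : Fin 4) : ℝ :=
  Matrix.det (Matrix.of fun i j : Fin 4 => if ![a, b, c, d] i = j then (1 : ℝ) else 0)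

/-- `(*F)_{cd} = ½ √(-g) ε_{abcd} F^{ab}`, the Hodge dual of a 2-form, in components. -/
def hodge2 (φ : OpenPartialHomeomorph M E4) (g : Tensor2 M) (F : Fin 4 → Fin 4 → M → ℝ)
    (c d : Fin 4) (x : M) : ℝ :=
  (1 / 2) * ∑ a, ∑ b, sqrtNegDet φ g x * eps a b c d *
    ∑ a', ∑ b', ginv φ g a a' x * ginv φ g b b' x * F a' b' x

/-- `(*J)_d = (1/6) √(-g) ε_{abcd} J^{abc}`, the Hodge dual of a 3-form, in components. -/
def hodge3 (φ : OpenPartialHomeomorph M E4) (g : Tensor2 M) (J : Fin 4 → Fin 4 → Fin 4 → M → ℝ)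
    (d : Fin 4) (x : M) : ℝ :=
  (1 / 6) * ∑ a, ∑ b, ∑ c, sqrtNegDet φ g x * eps a b c d *
    ∑ a', ∑ b', ∑ c', ginv φ g a a' x * ginv φ g b b' x * ginv φ g c c' x * J a' b' c' x

/-- The exterior derivative of a 2-form, in components. -/
def extDeriv2 (φ : OpenPartialHomeomorph M E4) (F : Fin 4 → Fin 4 → M → ℝ)
    (a b c : Fin 4) (x : M) : ℝ :=
  pd φ a (F b c) x + pd φ b (F c a) x + pd φ c (F a b) x

/-- The current density 1-form `j = * d * F`, in components. -/
def current (φ : OpenPartialHomeomorph M E4) (g : Tensor2 M) (F : Tensor2 M)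
    (d : Fin 4) (x : M) : ℝ :=
  hodge3 φ g (extDeriv2 φ (hodge2 φ g (comp2 φ F))) d x

/-- The current vector field `j♯`, in components. -/
def currentSharp (φ : OpenPartialHomeomorph M E4) (g : Tensor2 M) (F : Tensor2 M)
    (a : Fin 4) (x : M) : ℝ :=
  ∑ d, ginv φ g a d x * current φ g F d x

/-- `F` is a smooth 2-form on the domain of the chart: it is alternating, and its components are
smooth functions. -/
def IsTwoFormOn (φ : OpenPartialHomeomorph M E4) (F : Tensor2 M) : Prop :=
  (∀ i j, SmoothFunOn (comp2 φ F i j) φ.source) ∧ ∀ x ∈ φ.source, ∀ v, F x v v = 0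

/-- On the domain of `φ`, the 2-form `F` is a force-free electromagnetic field, that is `dF = 0`
and `i_{j♯} F = 0` with `j = * d * F`, and it is null, that is `F_{μν} F^{μν} = 0`. -/
structure IsNullForceFree (φ : OpenPartialHomeomorph M E4)
    (g : Tensor2 M) (F : Tensor2 M) : Prop where
  twoForm : IsTwoFormOn φ F
  closed : ∀ x ∈ φ.source, ∀ a b c, extDeriv2 φ (comp2 φ F) a b c x = 0
  forceFree : ∀ x ∈ φ.source, ∀ b, ∑ a, currentSharp φ g F a x * comp2 φ F a b x = 0
  null : ∀ x ∈ φ.source, ∑ a, ∑ b, comp2 φ F a b x *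
    (∑ a', ∑ b', ginv φ g a a' x * ginv φ g b b' x * comp2 φ F a' b' x) = 0

/-- The kernel of `F` is exactly the tangent space of the foliation at each point of `U`. -/
def KernelIs (F : Tensor2 M) (D : PlaneField M) (U : Set M) : Prop :=
  ∀ x ∈ U, ∀ v, v ∈ D x ↔ ∀ w, F x v w = 0

/-! ### Null foliations, adapted charts, adapted frames -/

/-- The slices of constant `x³, x⁴` of the chart `φ` are tangent to `D`: at every point of the
domain, `D` is the plane `dx³ = 0 = dx⁴`. -/
def IsAdaptedChart (D : PlaneField M) (φ : OpenPartialHomeomorph M E4) : Prop :=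
  IsChart φ ∧ ∀ x ∈ φ.source, ∀ v, v ∈ D x ↔ dx φ 2 x v = 0 ∧ dx φ 3 x v = 0

/-- A foliation by 2-dimensional submanifolds, given by the tangent planes `D` of its leaves:
around every point there is a chart whose slices `(x³, x⁴) = const` are tangent to `D` (the leaves
are the maximal connected integral manifolds of `D`). It is null when the restriction of the metric
to every tangent plane is degenerate. -/
structure IsNullFoliation (g : Tensor2 M) (D : PlaneField M) : Prop where
  flat : ∀ p : M, ∃ φ : OpenPartialHomeomorph M E4, p ∈ φ.source ∧ IsAdaptedChart D φ
  degenerate : ∀ x : M, ∃ v ∈ D x, v ≠ 0 ∧ ∀ w ∈ D x, g x v w = 0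

/-- `(s, l, α♯, n)` is a null foliation adapted frame on `U`; `a` stands for `α♯`, so that
`α = g(a, ·)`. -/
structure IsAdaptedFrame [IsManifold 𝓘(ℝ, E4) ∞ M] (g : Tensor2 M) (D : PlaneField M)
    (U : Set M) (s l a n : VField M) : Prop where
  smooth_s : SmoothVFieldOn s U
  smooth_l : SmoothVFieldOn l U
  smooth_a : SmoothVFieldOn a U
  smooth_n : SmoothVFieldOn n U
  span : ∀ x ∈ U, D x = Submodule.span ℝ {l x, s x}
  ll : ∀ x ∈ U, g x (l x) (l x) = 0
  nn : ∀ x ∈ U, g x (n x) (n x) = 0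
  nl : ∀ x ∈ U, g x (n x) (l x) = -1
  ss : ∀ x ∈ U, g x (s x) (s x) = 1
  aa : ∀ x ∈ U, g x (a x) (a x) = 1
  ls : ∀ x ∈ U, g x (l x) (s x) = 0
  la : ∀ x ∈ U, g x (l x) (a x) = 0
  sa : ∀ x ∈ U, g x (s x) (a x) = 0
  ns : ∀ x ∈ U, g x (n x) (s x) = 0
  na : ∀ x ∈ U, g x (n x) (a x) = 0

/-! ### The chart conditions -/

/-- `M^r = g^{r3} g^{34} - g^{33} g^{r4}`. -/
def Mvec (φ : OpenPartialHomeomorph M E4) (g : Tensor2 M) (r : Fin 4) (x : M) : ℝ :=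
  ginv φ g r 2 x * ginv φ g 2 3 x - ginv φ g 2 2 x * ginv φ g r 3 x

/-- `N^r = g^{r3} g^{44} - g^{34} g^{r4}`. -/
def Nvec (φ : OpenPartialHomeomorph M E4) (g : Tensor2 M) (r : Fin 4) (x : M) : ℝ :=
  ginv φ g r 2 x * ginv φ g 3 3 x - ginv φ g 2 3 x * ginv φ g r 3 x

/-- `∇_r V^r = (1 / √(-g)) ∂_r (√(-g) V^r)`. -/
def divg (φ : OpenPartialHomeomorph M E4) (g : Tensor2 M) (V : Fin 4 → M → ℝ) (x : M) : ℝ :=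
  (1 / sqrtNegDet φ g x) * ∑ r, pd φ r (fun y => sqrtNegDet φ g y * V r y) x

/-- `∇_r M^r = 0 = ∇_r N^r` on the domain of the chart. -/
def ChartCondition (φ : OpenPartialHomeomorph M E4) (g : Tensor2 M) : Prop :=
  ∀ x ∈ φ.source, divg φ g (Mvec φ g) x = 0 ∧ divg φ g (Nvec φ g) x = 0

/-! ### The frame conditions -/

/-- `dX♭(Y, Z) = (∂ᵢ Xⱼ - ∂ⱼ Xᵢ) Yⁱ Zʲ`, where `Xⱼ = g(X, ∂ⱼ)` are the components of `X♭`. -/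
def dFlat (φ : OpenPartialHomeomorph M E4) (g : Tensor2 M) (X Y Z : VField M) (x : M) : ℝ :=
  ∑ i, ∑ j, (pd φ i (fun y => g y (X y) (coordVec φ j y)) x
    - pd φ j (fun y => g y (X y) (coordVec φ i y)) x) * dx φ i x (Y x) * dx φ j x (Z x)

/-- `dα(l, α♯) = ds♭(l, s)` and `dl♭(l, α♯) = 0` on the domain of the chart. -/
def FrameCondition (φ : OpenPartialHomeomorph M E4) (g : Tensor2 M) (s l a : VField M) : Prop :=
  ∀ x ∈ φ.source, dFlat φ g a l a x = dFlat φ g s l s x ∧ dFlat φ g l l a x = 0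

/-- Christoffel symbols `Γᵏᵢⱼ` of the Levi-Civita connection in the chart. -/
def christoffel (φ : OpenPartialHomeomorph M E4) (g : Tensor2 M) (k i j : Fin 4) (x : M) : ℝ :=
  (1 / 2) * ∑ m, ginv φ g k m x *
    (pd φ i (comp2 φ g j m) x + pd φ j (comp2 φ g i m) x - pd φ m (comp2 φ g i j) x)

/-- `∇_X Y` for the Levi-Civita connection `∇`, on the domain of the chart. -/
def nabla (φ : OpenPartialHomeomorph M E4) (g : Tensor2 M) (X Y : VField M) : VField M :=
  fun x => ∑ k, (dirDeriv X (fun y => dx φ k y (Y y)) x +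
    ∑ i, ∑ j, christoffel φ g k i j x * dx φ i x (X x) * dx φ j x (Y x)) • coordVec φ k x

/-- `l` is pregeodesic on the domain of the chart: `∇_l l` is proportional to `l`. -/
def IsPregeodesic (φ : OpenPartialHomeomorph M E4) (g : Tensor2 M) (l : VField M) : Prop :=
  ∃ lam : M → ℝ, ∀ x ∈ φ.source, nabla φ g l l x = lam x • l x

/-- The null mean curvature `θ = ½ [g(∇_s l, s) + g(∇_{α♯} l, α♯)]`. -/
def nullMeanCurvature (φ : OpenPartialHomeomorph M E4) (g : Tensor2 M) (s l a : VField M)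
    (x : M) : ℝ :=
  (1 / 2) * (g x (nabla φ g s l x) (s x) + g x (nabla φ g a l x) (a x))

/-- Equipartition of null mean curvature with respect to `l`: `θ = g(∇_s l, s)`. -/
def HasEquipartition (φ : OpenPartialHomeomorph M E4) (g : Tensor2 M) (s l a : VField M) : Prop :=
  ∀ x ∈ φ.source, nullMeanCurvature φ g s l a x = g x (nabla φ g s l x) (s x)

/-! ### The class of solutions -/

/-- `u` is a smooth, nowhere vanishing function of `x³, x⁴`, that is, a function which is constant
along the leaves: `∂₁ u = 0 = ∂₂ u`. -/
def IsAdmissible (φ : OpenPartialHomeomorph M E4) (u : M → ℝ) : Prop :=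
  SmoothFunOn u φ.source ∧ ∀ x ∈ φ.source, u x ≠ 0 ∧ pd φ 0 u x = 0 ∧ pd φ 1 u x = 0

/-- `F = u dx³ ∧ dx⁴` on the domain of the chart. -/
def HasChartForm (φ : OpenPartialHomeomorph M E4) (u : M → ℝ) (F : Tensor2 M) : Prop :=
  ∀ x ∈ φ.source, ∀ v w,
    F x v w = u x * (dx φ 2 x v * dx φ 3 x w - dx φ 2 x w * dx φ 3 x v)

/-- `κ = (α₃ l₄ - α₄ l₃)⁻¹`, where `αᵢ` and `lᵢ` are the components of `α` and `l♭`. -/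
def kappa (φ : OpenPartialHomeomorph M E4) (g : Tensor2 M) (l a : VField M) (x : M) : ℝ :=
  (g x (a x) (coordVec φ 2 x) * g x (l x) (coordVec φ 3 x)
    - g x (a x) (coordVec φ 3 x) * g x (l x) (coordVec φ 2 x))⁻¹

/-- `F = (u κ) α ∧ l♭` on the domain of the chart. -/
def HasFrameForm (φ : OpenPartialHomeomorph M E4) (g : Tensor2 M) (l a : VField M) (u : M → ℝ)
    (F : Tensor2 M) : Prop :=
  ∀ x ∈ φ.source, ∀ v w,
    F x v w = (u x * kappa φ g l a x) *
      (g x (a x) v * g x (l x) w - g x (a x) w * g x (l x) v)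

/-- The null force-free fields on the domain of `φ` whose kernel is the tangent space of the
foliation are exactly the 2-forms `u dx³ ∧ dx⁴`, with `u` an arbitrary admissible function. -/
def ChartSolutionClass (φ : OpenPartialHomeomorph M E4)
    (g : Tensor2 M) (D : PlaneField M) : Prop :=
  ∀ F : Tensor2 M, IsTwoFormOn φ F →
    ((IsNullForceFree φ g F ∧ KernelIs F D φ.source) ↔
      ∃ u : M → ℝ, IsAdmissible φ u ∧ HasChartForm φ u F)

/-- The null force-free fields on the domain of `φ` whose kernel is the tangent space of the
foliation are exactly the 2-forms `(u κ) α ∧ l♭`, with `u` an arbitrary admissible function. -/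
def FrameSolutionClass (φ : OpenPartialHomeomorph M E4)
    (g : Tensor2 M) (D : PlaneField M) (l a : VField M) : Prop :=
  ∀ F : Tensor2 M, IsTwoFormOn φ F →
    ((IsNullForceFree φ g F ∧ KernelIs F D φ.source) ↔
      ∃ u : M → ℝ, IsAdmissible φ u ∧ HasFrameForm φ g l a u F)

end NullFFE

end

/-! Everything is computed from two facts: `dx³` and `dx⁴` kill `s` and `l`, and the inverse metric
is `s⊗s + a⊗a - l⊗n - n⊗l` (`IsAdaptedFrame.ginv_eq`). They give `M^r = T l^r a³` and `N^r = T l^r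
a⁴`, where `T = (dx³ ∧ dx⁴)(a, n)`. With `L = (dx¹ ∧ dx²)(l, s)`, the product `√(-g) T L` has square
1, so it is locally constant, while on a leaf `s♭ = (l¹ dx² - l² dx¹)/L`. Hence `div(T f l) = T (f
ds♭(l,s) + l(f))` for every smooth `f` (`divg_eq`).

So condition 1 says that `P = a³ ds♭(l,s) + l(a³)` and `Q = a⁴ ds♭(l,s) + l(a⁴)` vanish.
Differentiating `α(a) = 1` and `l♭(a) = 0` along `l` shows that `α₃P + α₄Q = ds♭(l,s) - dα(l,a)` and
`l₃P + l₄Q = -dl♭(l,a)`. The determinant of this system is `κ⁻¹ ≠ 0`, which gives 1 ⇔ 2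
(`chartCondition_iff`).

For 2 ⇔ 3, a torsion-free metric connection turns the three exterior derivatives `dα(l,a)`,
`ds♭(l,s)`, `dl♭(l,a)` into `g(∇_a l, a)`, `g(∇_s l, s)`, `g(∇_l l, a)`. The last one is the only
obstruction to `l` being pregeodesic (`frameCondition_iff`).

A 2-form with kernel `Tℱ` is `u dx³ ∧ dx⁴`. It is closed iff `u` is constant along the leaves, it is
automatically null, and its current is minus the divergence of `F^{ab}` (`currentSharp_eq`). Since
`F^{r3} = u M^r` and `F^{r4} = u N^r`, for such `u` the force-free equation is condition 1, whatever
`u` is (`isNullForceFree_iff`). Finally `κ α ∧ l♭ = dx³ ∧ dx⁴`, so 4 and 5 describe the same forms.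
-/

namespace NullFFE

/-! ### Calculus of smooth functions and coordinate fields in a chart. -/

section Calculus

variable {M : Type*} [TopologicalSpace M] [ChartedSpace E4 M]
  {φ : OpenPartialHomeomorph M E4} {g : Tensor2 M} {x : M}

theorem SmoothFunOn.mdifferentiableAt {f : M → ℝ} (hf : SmoothFunOn f φ.source)
    (hx : x ∈ φ.source) : MDifferentiableAt 𝓘(ℝ, E4) 𝓘(ℝ, ℝ) f x :=
  ((hf x hx).contMDiffAt (φ.open_source.mem_nhds hx)).mdifferentiableAt (by simp)

theorem SmoothFunOn.congr {f h : M → ℝ} (hf : SmoothFunOn f φ.source)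
    (e : ∀ y ∈ φ.source, h y = f y) : SmoothFunOn h φ.source :=
  ContMDiffOn.congr hf e

theorem smoothFunOn_const (c : ℝ) : SmoothFunOn (fun _ : M => c) φ.source :=
  contMDiffOn_const

theorem SmoothFunOn.add {f h : M → ℝ} (hf : SmoothFunOn f φ.source)
    (hh : SmoothFunOn h φ.source) : SmoothFunOn (fun y => f y + h y) φ.source :=
  ContMDiffOn.add hf hh

theorem SmoothFunOn.neg {f : M → ℝ} (hf : SmoothFunOn f φ.source) :
    SmoothFunOn (fun y => - f y) φ.source :=
  ContMDiffOn.neg hf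

theorem SmoothFunOn.sub {f h : M → ℝ} (hf : SmoothFunOn f φ.source)
    (hh : SmoothFunOn h φ.source) : SmoothFunOn (fun y => f y - h y) φ.source :=
  ContMDiffOn.sub hf hh

theorem SmoothFunOn.mul {f h : M → ℝ} (hf : SmoothFunOn f φ.source)
    (hh : SmoothFunOn h φ.source) : SmoothFunOn (fun y => f y * h y) φ.source := by
  have := ContMDiffOn.smul hf hh
  simpa [SmoothFunOn] using! this

theorem SmoothFunOn.comp_contDiffAt {f : M → ℝ} (hf : SmoothFunOn f φ.source) {r : ℝ → ℝ}
    (hr : ∀ y ∈ φ.source, ContDiffAt ℝ ∞ r (f y)) : SmoothFunOn (fun y => r (f y)) φ.source :=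
  fun y hy => ((hr y hy).contMDiffAt.comp y
    ((hf y hy).contMDiffAt (φ.open_source.mem_nhds hy))).contMDiffWithinAt

theorem SmoothFunOn.sum {ι : Type*} (t : Finset ι) {f : ι → M → ℝ}
    (hf : ∀ i ∈ t, SmoothFunOn (f i) φ.source) :
    SmoothFunOn (fun y => ∑ i ∈ t, f i y) φ.source :=
  contMDiffOn_finsetSum hf

theorem SmoothFunOn.prod {ι : Type*} (t : Finset ι) {f : ι → M → ℝ}
    (hf : ∀ i ∈ t, SmoothFunOn (f i) φ.source) :
    SmoothFunOn (fun y => ∏ i ∈ t, f i y) φ.source :=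
  contMDiffOn_finsetProd hf

theorem dirDeriv_congr {f h : M → ℝ} {X : VField M} (hx : x ∈ φ.source)
    (e : ∀ y ∈ φ.source, f y = h y) : dirDeriv X f x = dirDeriv X h x := by
  have : f =ᶠ[nhds x] h := Filter.eventuallyEq_of_mem (φ.open_source.mem_nhds hx) e
  unfold dirDeriv mvfderiv
  rw [this.mfderiv_eq, e x hx]

theorem pd_congr {f h : M → ℝ} (i : Fin 4) (hx : x ∈ φ.source)
    (e : ∀ y ∈ φ.source, f y = h y) : pd φ i f x = pd φ i h x :=
  dirDeriv_congr hx e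

@[simp] theorem pd_const (i : Fin 4) (c : ℝ) : pd φ i (fun _ => c) x = 0 := by
  simp [pd, dirDeriv, mvfderiv_const]

theorem pd_eq_zero {f : M → ℝ} (i : Fin 4) (c : ℝ) (hx : x ∈ φ.source)
    (e : ∀ y ∈ φ.source, f y = c) : pd φ i f x = 0 := by
  rw [pd_congr i hx e, pd_const]

theorem pd_add {f h : M → ℝ} (i : Fin 4) (hx : x ∈ φ.source) (hf : SmoothFunOn f φ.source)
    (hh : SmoothFunOn h φ.source) :
    pd φ i (fun y => f y + h y) x = pd φ i f x + pd φ i h x := by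
  simp [pd, dirDeriv, mvfderiv_fun_add (hf.mdifferentiableAt hx) (hh.mdifferentiableAt hx)]

theorem pd_mul {f h : M → ℝ} (i : Fin 4) (hx : x ∈ φ.source) (hf : SmoothFunOn f φ.source)
    (hh : SmoothFunOn h φ.source) :
    pd φ i (fun y => f y * h y) x = pd φ i f x * h x + f x * pd φ i h x := by
  simp [pd, dirDeriv, mvfderiv_fun_mul (hf.mdifferentiableAt hx) (hh.mdifferentiableAt hx)]
  ring

theorem pd_const_mul {f : M → ℝ} (i : Fin 4) (c : ℝ) (hx : x ∈ φ.source)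
    (hf : SmoothFunOn f φ.source) : pd φ i (fun y => c * f y) x = c * pd φ i f x := by
  simp [pd_mul i hx (smoothFunOn_const c) hf]

theorem pd_sum {ι : Type*} (t : Finset ι) {f : ι → M → ℝ} (i : Fin 4) (hx : x ∈ φ.source)
    (hf : ∀ k, SmoothFunOn (f k) φ.source) :
    pd φ i (fun y => ∑ k ∈ t, f k y) x = ∑ k ∈ t, pd φ i (f k) x := by
  classical
  induction t using Finset.induction_on with
  | empty => simp
  | insert k t hk ih =>
    simp only [Finset.sum_insert hk]
    rw [pd_add i hx (hf k) (SmoothFunOn.sum t fun k _ => hf k), ih]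

theorem dx_add (i : Fin 4) (v w : TangentSpace 𝓘(ℝ, E4) x) :
    dx φ i x (v + w) = dx φ i x v + dx φ i x w := by
  simp [dx]

theorem dx_smul (i : Fin 4) (c : ℝ) (v : TangentSpace 𝓘(ℝ, E4) x) :
    dx φ i x (c • v) = c * dx φ i x v := by
  simp [dx]

theorem IsChart.isInvertible_mfderiv (hφ : IsChart φ) (hx : x ∈ φ.source) :
    (mfderiv 𝓘(ℝ, E4) 𝓘(ℝ, E4) φ x).IsInvertible := by
  have hd : φ.MDifferentiable 𝓘(ℝ, E4) 𝓘(ℝ, E4) :=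
    ⟨(contMDiffOn_of_mem_maximalAtlas hφ).mdifferentiableOn (by simp),
      (contMDiffOn_symm_of_mem_maximalAtlas hφ).mdifferentiableOn (by simp)⟩
  exact ⟨hd.mfderiv hx, rfl⟩

theorem IsChart.dx_coordVec (hφ : IsChart φ) (hx : x ∈ φ.source) (i j : Fin 4) :
    dx φ i x (coordVec φ j x) = if i = j then 1 else 0 := by
  have h := (hφ.isInvertible_mfderiv hx).self_apply_inverse
    ((NormedSpace.fromTangentSpace (φ x)).symm (EuclideanSpace.single j (1 : ℝ)))
  unfold dx coordVec mvfderiv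
  rw [VectorField.mpullback_apply]
  simp only [ContinuousLinearMap.comp_apply]
  erw [h]
  change (EuclideanSpace.single j (1 : ℝ) : E4) i = _
  simp

theorem IsChart.sum_dx_smul_coordVec (hφ : IsChart φ) (hx : x ∈ φ.source)
    (v : TangentSpace 𝓘(ℝ, E4) x) : ∑ i, dx φ i x v • coordVec φ i x = v := by
  have hinj : Function.Injective (mfderiv 𝓘(ℝ, E4) 𝓘(ℝ, E4) φ x) :=
    (hφ.isInvertible_mfderiv hx).injective
  apply hinj
  have key : ∀ i, dx φ i x (∑ i, dx φ i x v • coordVec φ i x) = dx φ i x v := by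
    intro i
    simp only [Fin.sum_univ_four, dx_add, dx_smul, hφ.dx_coordVec hx]
    fin_cases i <;> simp
  exact PiLp.ext fun i => key i

theorem IsChart.dirDeriv_eq_sum (hφ : IsChart φ) (hx : x ∈ φ.source) (X : VField M) (f : M → ℝ) :
    dirDeriv X f x = ∑ i, dx φ i x (X x) * pd φ i f x := by
  conv_lhs => rw [dirDeriv, ← hφ.sum_dx_smul_coordVec hx (X x)]
  simp [pd, dirDeriv]

variable [IsManifold 𝓘(ℝ, E4) ∞ M]

theorem IsChart.smooth_coordVec (hφ : IsChart φ) (i : Fin 4) :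
    SmoothVFieldOn (coordVec φ i) φ.source := by
  intro y hy
  refine ContMDiffAt.contMDiffWithinAt ?_
  refine ContMDiffAt.mpullback_vectorField_preimage (n := ∞) ?_
    (contMDiffAt_of_mem_maximalAtlas hφ hy) (hφ.isInvertible_mfderiv hy) (by simp)
  exact contMDiffAt_vectorSpace_iff_contDiffAt.2 contDiffAt_const

theorem SmoothTensor2On.apply {T : Tensor2 M} {X Y : VField M}
    (hT : SmoothTensor2On T φ.source) (hX : SmoothVFieldOn X φ.source)
    (hY : SmoothVFieldOn Y φ.source) : SmoothFunOn (fun y => T y (X y) (Y y)) φ.source := by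
  intro y hy
  have := (hT y hy).clm_bundle_apply₂ (F₁ := E4) (F₂ := E4) (F₃ := ℝ) 
    (E₃ := Bundle.Trivial M ℝ) (b := id) (hX y hy) (hY y hy)
  simp only [Bundle.contMDiffWithinAt_totalSpace] at this
  exact this.2

end Calculus

/-! ### Components of tensors, and smoothness of those of the metric. -/

section Components

variable {M : Type*} [TopologicalSpace M] [ChartedSpace E4 M]
  {φ : OpenPartialHomeomorph M E4} {g : Tensor2 M} {x : M}

theorem IsChart.apply_eq_sum (hφ : IsChart φ) (hx : x ∈ φ.source) (T : Tensor2 M)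
    (v w : TangentSpace 𝓘(ℝ, E4) x) :
    T x v w = ∑ i, ∑ j, dx φ i x v * dx φ j x w * comp2 φ T i j x := by
  conv_lhs => rw [← hφ.sum_dx_smul_coordVec hx v, ← hφ.sum_dx_smul_coordVec hx w]
  simp only [map_sum, map_smul, sum_apply, smul_apply,
    smul_eq_mul, comp2, Finset.mul_sum]
  rw [Finset.sum_comm]
  exact Finset.sum_congr rfl fun i _ => Finset.sum_congr rfl fun j _ => by ring

theorem IsChart.apply_coordVec_eq_sum (hφ : IsChart φ) (hx : x ∈ φ.source) (T : Tensor2 M)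
    (v : TangentSpace 𝓘(ℝ, E4) x) (j : Fin 4) :
    T x v (coordVec φ j x) = ∑ i, dx φ i x v * comp2 φ T i j x := by
  conv_lhs => rw [← hφ.sum_dx_smul_coordVec hx v]
  simp [comp2]

theorem IsChart.apply_eq_sum_lower (hφ : IsChart φ) (hx : x ∈ φ.source) (T : Tensor2 M)
    (v w : TangentSpace 𝓘(ℝ, E4) x) :
    T x v w = ∑ j, T x v (coordVec φ j x) * dx φ j x w := by
  conv_lhs => rw [← hφ.sum_dx_smul_coordVec hx w]
  simp [mul_comm]

theorem IsChart.dx_sum_smul_coordVec (hφ : IsChart φ) (hx : x ∈ φ.source) (c : Fin 4 → ℝ)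
    (i : Fin 4) : dx φ i x (∑ k, c k • coordVec φ k x) = c i := by
  simp only [Fin.sum_univ_four, dx_add, dx_smul, hφ.dx_coordVec hx]
  fin_cases i <;> simp

theorem IsChart.ext_dx (hφ : IsChart φ) (hx : x ∈ φ.source) {v w : TangentSpace 𝓘(ℝ, E4) x}
    (h : ∀ i, dx φ i x v = dx φ i x w) : v = w := by
  rw [← hφ.sum_dx_smul_coordVec hx v, ← hφ.sum_dx_smul_coordVec hx w]
  simp only [h]

theorem IsAdaptedChart.coordVec_mem {D : PlaneField M} (hφ : IsAdaptedChart D φ) (hx : x ∈ φ.source) :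
    coordVec φ 0 x ∈ D x ∧ coordVec φ 1 x ∈ D x := by
  simp [hφ.2 x hx, hφ.1.dx_coordVec hx]

variable [IsManifold 𝓘(ℝ, E4) ∞ M]

/-- Symmetry is not a field of `IsLorentzMetric`: it follows from the diagonal form in an
orthonormal basis. -/
theorem IsLorentzMetric.symm (hg : IsLorentzMetric g) (v w : TangentSpace 𝓘(ℝ, E4) x) :
    g x v w = g x w v := by
  obtain ⟨b, hb⟩ := hg.signature x
  have h : ∀ v w, g x v w = ∑ i, ∑ j, b.repr v i * b.repr w j * g x (b i) (b j) := by
    intro v w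
    conv_lhs => rw [← b.sum_repr v, ← b.sum_repr w]
    simp only [map_sum, map_smul, sum_apply, smul_apply,
      smul_eq_mul, Finset.mul_sum]
    rw [Finset.sum_comm]
    exact Finset.sum_congr rfl fun i _ => Finset.sum_congr rfl fun j _ => by ring
  rw [h v w, h w v, Finset.sum_comm]
  refine Finset.sum_congr rfl fun i _ => Finset.sum_congr rfl fun j _ => ?_
  rw [hb, hb]
  by_cases hij : i = j
  · subst hij; ring
  · simp [hij, Ne.symm hij]

theorem IsLorentzMetric.comp2_symm (hg : IsLorentzMetric g) (i j : Fin 4) :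
    comp2 φ g i j x = comp2 φ g j i x :=
  hg.symm _ _

theorem IsLorentzMetric.smoothOn (hg : IsLorentzMetric g) (U : Set M) : SmoothTensor2On g U :=
  hg.smooth.mono (Set.subset_univ U)

theorem IsLorentzMetric.smooth_comp2 (hg : IsLorentzMetric g) (hφ : IsChart φ) (i j : Fin 4) :
    SmoothFunOn (comp2 φ g i j) φ.source :=
  (hg.smoothOn _).apply (hφ.smooth_coordVec i) (hφ.smooth_coordVec j)

theorem IsLorentzMetric.smooth_lower (hg : IsLorentzMetric g) (hφ : IsChart φ) {X : VField M}
    (hX : SmoothVFieldOn X φ.source) (j : Fin 4) :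
    SmoothFunOn (fun y => g y (X y) (coordVec φ j y)) φ.source :=
  (hg.smoothOn _).apply hX (hφ.smooth_coordVec j)

theorem IsLorentzMetric.smooth_gram_det (hg : IsLorentzMetric g) (hφ : IsChart φ) :
    SmoothFunOn (fun y => (gram φ g y).det) φ.source := by
  simp only [Matrix.det_apply']
  exact SmoothFunOn.sum _ fun σ _ => (smoothFunOn_const _).mul
    (SmoothFunOn.prod _ fun i _ => hg.smooth_comp2 hφ _ _)

end Components

/-! ### The metric in an adapted frame -/

section Frame

variable {M : Type*} [TopologicalSpace M] [ChartedSpace E4 M] [IsManifold 𝓘(ℝ, E4) ∞ M]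
  {φ : OpenPartialHomeomorph M E4} {g : Tensor2 M} {D : PlaneField M} {s l a n : VField M} {x : M}

/-- The matrix of chart components of the frame `(s, l, a, n)`. -/
noncomputable def frameMatrix (φ : OpenPartialHomeomorph M E4) (s l a n : VField M) (x : M) :
    Matrix (Fin 4) (Fin 4) ℝ :=
  Matrix.of fun i => ![dx φ i x (s x), dx φ i x (l x), dx φ i x (a x), dx φ i x (n x)]

/-- The scalar products in an adapted frame. -/
noncomputable def frameGram : Matrix (Fin 4) (Fin 4) ℝ :=
  !![1, 0, 0, 0; 0, 0, 0, -1; 0, 0, 1, 0; 0, -1, 0, 0]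

theorem frameGram_mul_self : frameGram * frameGram = 1 := by
  ext i j
  fin_cases i <;> fin_cases j <;> simp [frameGram, Matrix.mul_apply, Fin.sum_univ_four]

theorem det_frameGram : frameGram.det = -1 := by
  simp [frameGram, Matrix.det_succ_row_zero, Fin.sum_univ_succ, Fin.succAbove]

theorem IsAdaptedFrame.frameMatrix_gram (hf : IsAdaptedFrame g D φ.source s l a n)
    (hg : IsLorentzMetric g) (hφ : IsChart φ) (hx : x ∈ φ.source) :
    (frameMatrix φ s l a n x).transpose * gram φ g x * frameMatrix φ s l a n x = frameGram := by
  have key : ∀ (X : Fin 4 → TangentSpace 𝓘(ℝ, E4) x),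
      (∀ i k, frameMatrix φ s l a n x i k = dx φ i x (X k)) → ∀ k m,
      ((frameMatrix φ s l a n x).transpose * gram φ g x * frameMatrix φ s l a n x) k m
        = g x (X k) (X m) := by
    intro X hX k m
    rw [hφ.apply_eq_sum hx, Matrix.mul_apply, Finset.sum_comm]
    refine Finset.sum_congr rfl fun j _ => ?_
    rw [Matrix.mul_apply, Finset.sum_mul]
    refine Finset.sum_congr rfl fun i _ => ?_
    rw [Matrix.transpose_apply, hX, hX, gram, Matrix.of_apply]
    ring
  have h := key ![s x, l x, a x, n x] (by
    intro i k
    fin_cases k <;> rfl)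
  ext k m
  rw [h]
  have sl := (hg.symm (s x) (l x)).trans (hf.ls x hx)
  have al := (hg.symm (a x) (l x)).trans (hf.la x hx)
  have as := (hg.symm (a x) (s x)).trans (hf.sa x hx)
  have sn := (hg.symm (s x) (n x)).trans (hf.ns x hx)
  have an := (hg.symm (a x) (n x)).trans (hf.na x hx)
  have ln := (hg.symm (l x) (n x)).trans (hf.nl x hx)
  fin_cases k <;> fin_cases m <;>
    simp [frameGram, sl, al, as, sn, an, ln, hf.ll x hx, hf.nn x hx, hf.nl x hx, hf.ss x hx,
      hf.aa x hx, hf.ls x hx, hf.la x hx, hf.sa x hx, hf.ns x hx, hf.na x hx]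

/-- From `EᵀGE = J` and `J² = 1`, the matrix `JEᵀ` is a left inverse of `GE`, hence also a right
inverse. This makes the inverse metric explicit. -/
theorem IsAdaptedFrame.gram_mul_frame (hf : IsAdaptedFrame g D φ.source s l a n)
    (hg : IsLorentzMetric g) (hφ : IsChart φ) (hx : x ∈ φ.source) :
    gram φ g x * (frameMatrix φ s l a n x * frameGram * (frameMatrix φ s l a n x).transpose)
      = 1 := by
  have h := hf.frameMatrix_gram hg hφ hx
  set E := frameMatrix φ s l a n x
  have h1 : (frameGram * E.transpose) * (gram φ g x * E) = 1 := by
    rw [Matrix.mul_assoc, ← Matrix.mul_assoc _ _ E, h, frameGram_mul_self]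
  have h2 := mul_eq_one_comm.1 h1
  rw [← h2]
  simp only [Matrix.mul_assoc]

theorem IsAdaptedFrame.ginv_eq (hf : IsAdaptedFrame g D φ.source s l a n)
    (hg : IsLorentzMetric g) (hφ : IsChart φ) (hx : x ∈ φ.source) (i j : Fin 4) :
    ginv φ g i j x = dx φ i x (s x) * dx φ j x (s x) + dx φ i x (a x) * dx φ j x (a x)
      - dx φ i x (l x) * dx φ j x (n x) - dx φ i x (n x) * dx φ j x (l x) := by
  rw [ginv, Matrix.inv_eq_right_inv (hf.gram_mul_frame hg hφ hx)]
  simp [Matrix.mul_apply, Fin.sum_univ_four, frameMatrix, frameGram]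
  ring

theorem IsAdaptedFrame.gram_mul_ginv (hf : IsAdaptedFrame g D φ.source s l a n)
    (hg : IsLorentzMetric g) (hφ : IsChart φ) (hx : x ∈ φ.source) :
    gram φ g x * (gram φ g x)⁻¹ = 1 := by
  rw [Matrix.inv_eq_right_inv (hf.gram_mul_frame hg hφ hx), hf.gram_mul_frame hg hφ hx]

theorem IsAdaptedFrame.gram_det (hf : IsAdaptedFrame g D φ.source s l a n)
    (hg : IsLorentzMetric g) (hφ : IsChart φ) (hx : x ∈ φ.source) :
    (gram φ g x).det * (frameMatrix φ s l a n x).det ^ 2 = -1 := by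
  rw [← det_frameGram, ← hf.frameMatrix_gram hg hφ hx, Matrix.det_mul, Matrix.det_mul,
    Matrix.det_transpose]
  ring

theorem IsAdaptedFrame.gram_det_neg (hf : IsAdaptedFrame g D φ.source s l a n)
    (hg : IsLorentzMetric g) (hφ : IsChart φ) (hx : x ∈ φ.source) : (gram φ g x).det < 0 := by
  have := hf.gram_det hg hφ hx
  by_contra! h
  nlinarith [mul_nonneg h (sq_nonneg (frameMatrix φ s l a n x).det)]

theorem IsAdaptedFrame.sqrtNegDet_pos (hf : IsAdaptedFrame g D φ.source s l a n)
    (hg : IsLorentzMetric g) (hφ : IsChart φ) (hx : x ∈ φ.source) : 0 < sqrtNegDet φ g x :=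
  Real.sqrt_pos.2 (by linarith [hf.gram_det_neg hg hφ hx])

theorem IsAdaptedFrame.sqrtNegDet_sq (hf : IsAdaptedFrame g D φ.source s l a n)
    (hg : IsLorentzMetric g) (hφ : IsChart φ) (hx : x ∈ φ.source) :
    sqrtNegDet φ g x ^ 2 = -(gram φ g x).det :=
  Real.sq_sqrt (by linarith [hf.gram_det_neg hg hφ hx])

theorem IsAdaptedFrame.smooth_sqrtNegDet (hf : IsAdaptedFrame g D φ.source s l a n)
    (hg : IsLorentzMetric g) (hφ : IsChart φ) : SmoothFunOn (sqrtNegDet φ g) φ.source :=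
  ((hg.smooth_gram_det hφ).neg).comp_contDiffAt (r := Real.sqrt) fun _ hy =>
    Real.contDiffAt_sqrt (by linarith [hf.gram_det_neg hg hφ hy])

theorem IsAdaptedFrame.smooth_ginv (hf : IsAdaptedFrame g D φ.source s l a n)
    (hg : IsLorentzMetric g) (hφ : IsChart φ) (i j : Fin 4) :
    SmoothFunOn (ginv φ g i j) φ.source := by
  have hadj : SmoothFunOn (fun y => (gram φ g y).adjugate i j) φ.source := by
    simp only [Matrix.adjugate_apply, Matrix.det_apply']
    refine SmoothFunOn.sum _ fun σ _ => (smoothFunOn_const _).mul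
      (SmoothFunOn.prod _ fun k _ => ?_)
    by_cases hk : σ k = j
    · simpa [Matrix.updateRow_apply, hk] using smoothFunOn_const _
    · simpa [Matrix.updateRow_apply, hk] using! hg.smooth_comp2 hφ _ _
  have hdet : SmoothFunOn (fun y => ((gram φ g y).det)⁻¹) φ.source :=
    (hg.smooth_gram_det hφ).comp_contDiffAt (r := fun t => t⁻¹) fun y hy =>
      contDiffAt_inv ℝ (hf.gram_det_neg hg hφ hy).ne
  refine (hdet.mul hadj).congr fun y _ => ?_
  simp [ginv, Matrix.inv_def, Ring.inverse_eq_inv']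

theorem IsAdaptedFrame.dx_eq_sum_ginv (hf : IsAdaptedFrame g D φ.source s l a n)
    (hg : IsLorentzMetric g) (hφ : IsChart φ) (hx : x ∈ φ.source) (i : Fin 4)
    (v : TangentSpace 𝓘(ℝ, E4) x) :
    dx φ i x v = ∑ j, g x v (coordVec φ j x) * ginv φ g j i x := by
  have h := hf.gram_mul_ginv hg hφ hx
  have h' : ∀ k i, ∑ j, comp2 φ g k j x * ginv φ g j i x = if k = i then 1 else 0 := by
    intro k i
    have := congrFun (congrFun h k) i
    rwa [Matrix.mul_apply, Matrix.one_apply] at this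
  simp only [hφ.apply_coordVec_eq_sum hx, Finset.sum_mul]
  rw [Finset.sum_comm]
  simp only [mul_assoc, ← Finset.mul_sum, h']
  simp

/-- The lowered components of `X` are smooth as values of the metric on smooth fields; raising the
index with the smooth inverse metric recovers `dxⁱ(X)`. -/
theorem IsAdaptedFrame.smooth_dx (hf : IsAdaptedFrame g D φ.source s l a n)
    (hg : IsLorentzMetric g) (hφ : IsChart φ) {X : VField M} (hX : SmoothVFieldOn X φ.source)
    (i : Fin 4) : SmoothFunOn (fun y => dx φ i y (X y)) φ.source :=
  (SmoothFunOn.sum Finset.univ fun j _ =>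
    (hg.smooth_lower hφ hX j).mul (hf.smooth_ginv hg hφ j i)).congr fun _ hy =>
      hf.dx_eq_sum_ginv hg hφ hy i _

end Frame

/-! ### The Levi-Civita connection: vanishing torsion and metric compatibility. -/

section Connection

variable {M : Type*} [TopologicalSpace M] [ChartedSpace E4 M] [IsManifold 𝓘(ℝ, E4) ∞ M]
  {φ : OpenPartialHomeomorph M E4} {g : Tensor2 M} {D : PlaneField M} {s l a n : VField M} {x : M}

theorem IsAdaptedFrame.sum_christoffel_mul (hf : IsAdaptedFrame g D φ.source s l a n)
    (hg : IsLorentzMetric g) (hφ : IsChart φ) (hx : x ∈ φ.source) (i j m : Fin 4) :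
    ∑ k, christoffel φ g k i j x * comp2 φ g k m x = (1 / 2) *
      (pd φ i (comp2 φ g j m) x + pd φ j (comp2 φ g i m) x - pd φ m (comp2 φ g i j) x) := by
  have h := hf.gram_mul_ginv hg hφ hx
  have h' : ∀ p, ∑ k, ginv φ g k p x * comp2 φ g k m x = if m = p then 1 else 0 := by
    intro p
    have := congrFun (congrFun h m) p
    rw [Matrix.mul_apply, Matrix.one_apply] at this
    rw [← this]
    refine Finset.sum_congr rfl fun k _ => ?_
    rw [hg.comp2_symm k m, mul_comm]
    rfl
  simp only [christoffel, mul_assoc, ← Finset.mul_sum, Finset.sum_mul]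
  rw [Finset.sum_comm]
  congr 1
  have : ∀ p, ∑ k, ginv φ g k p x * ((pd φ i (comp2 φ g j p) x + pd φ j (comp2 φ g i p) x
      - pd φ p (comp2 φ g i j) x) * comp2 φ g k m x) =
      (if m = p then 1 else 0) * (pd φ i (comp2 φ g j p) x + pd φ j (comp2 φ g i p) x
      - pd φ p (comp2 φ g i j) x) := by
    intro p
    rw [← h' p, Finset.sum_mul]
    exact Finset.sum_congr rfl fun k _ => by ring
  simp only [this]
  simp

/-- The components `(∇_i X)_m` of the covariant derivative of `X♭`. -/
noncomputable def covDerivLower (φ : OpenPartialHomeomorph M E4) (g : Tensor2 M) (X : VField M)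
    (i m : Fin 4) (x : M) : ℝ :=
  ∑ k, (pd φ i (fun y => dx φ k y (X y)) x * comp2 φ g k m x + (1 / 2) *
    (pd φ i (comp2 φ g k m) x + pd φ k (comp2 φ g i m) x - pd φ m (comp2 φ g i k) x) *
      dx φ k x (X x))

/-- Pairing with `g` cancels the inverse metric in the Christoffel symbols. Torsion and
compatibility then become algebraic identities in the first derivatives of the components. -/
theorem IsAdaptedFrame.apply_nabla (hf : IsAdaptedFrame g D φ.source s l a n)
    (hg : IsLorentzMetric g) (hφ : IsChart φ) (hx : x ∈ φ.source) (X Y : VField M)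
    (z : TangentSpace 𝓘(ℝ, E4) x) :
    g x (nabla φ g Y X x) z =
      ∑ i, ∑ m, dx φ i x (Y x) * dx φ m x z * covDerivLower φ g X i m x := by
  rw [hφ.apply_eq_sum hx, Finset.sum_comm]
  conv_rhs => rw [Finset.sum_comm]
  refine Finset.sum_congr rfl fun m _ => ?_
  simp only [nabla, hφ.dx_sum_smul_coordVec hx, hφ.dirDeriv_eq_sum hx]
  have h1 : ∑ k, (∑ i, ∑ j, christoffel φ g k i j x * dx φ i x (Y x) * dx φ j x (X x)) *
      comp2 φ g k m x = ∑ i, ∑ j, dx φ i x (Y x) * dx φ j x (X x) * ((1 / 2) *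
      (pd φ i (comp2 φ g j m) x + pd φ j (comp2 φ g i m) x - pd φ m (comp2 φ g i j) x)) := by
    simp only [← hf.sum_christoffel_mul hg hφ hx, Finset.sum_mul, Finset.mul_sum]
    rw [Finset.sum_comm]
    refine Finset.sum_congr rfl fun i _ => ?_
    rw [Finset.sum_comm]
    exact Finset.sum_congr rfl fun j _ => Finset.sum_congr rfl fun k _ => by ring
  have h2 : ∑ k, (∑ i, dx φ i x (Y x) * pd φ i (fun y => dx φ k y (X y)) x) * comp2 φ g k m x
      = ∑ i, ∑ k, dx φ i x (Y x) * (pd φ i (fun y => dx φ k y (X y)) x * comp2 φ g k m x) := by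
    simp only [Finset.sum_mul]
    rw [Finset.sum_comm]
    exact Finset.sum_congr rfl fun j _ => Finset.sum_congr rfl fun k _ => by ring
  calc _ = dx φ m x z *
        (∑ k, (∑ i, dx φ i x (Y x) * pd φ i (fun y => dx φ k y (X y)) x) * comp2 φ g k m x
        + ∑ k, (∑ i, ∑ j, christoffel φ g k i j x * dx φ i x (Y x) * dx φ j x (X x)) *
      comp2 φ g k m x) := by
        rw [← Finset.sum_add_distrib, Finset.mul_sum]
        exact Finset.sum_congr rfl fun k _ => by ring
    _ = _ := by
        rw [h1, h2, ← Finset.sum_add_distrib, Finset.mul_sum]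
        refine Finset.sum_congr rfl fun i _ => ?_
        rw [← Finset.sum_add_distrib, covDerivLower, Finset.mul_sum, Finset.mul_sum]
        exact Finset.sum_congr rfl fun k _ => by ring

theorem IsAdaptedFrame.pd_lower (hf : IsAdaptedFrame g D φ.source s l a n)
    (hg : IsLorentzMetric g) (hφ : IsChart φ) (hx : x ∈ φ.source) {X : VField M}
    (hX : SmoothVFieldOn X φ.source) (i j : Fin 4) :
    pd φ i (fun y => g y (X y) (coordVec φ j y)) x =
      ∑ k, (pd φ i (fun y => dx φ k y (X y)) x * comp2 φ g k j x
        + dx φ k x (X x) * pd φ i (comp2 φ g k j) x) := by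
  rw [pd_congr i hx fun y hy => hφ.apply_coordVec_eq_sum hy g (X y) j, pd_sum _ i hx fun k =>
    (hf.smooth_dx hg hφ hX k).mul (hg.smooth_comp2 hφ k j)]
  exact Finset.sum_congr rfl fun k _ =>
    pd_mul i hx (hf.smooth_dx hg hφ hX k) (hg.smooth_comp2 hφ k j)

/-- The exterior derivative of `X♭` is the antisymmetrized covariant derivative. -/
theorem IsAdaptedFrame.dFlat_eq (hf : IsAdaptedFrame g D φ.source s l a n)
    (hg : IsLorentzMetric g) (hφ : IsChart φ) (hx : x ∈ φ.source) {X : VField M}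
    (hX : SmoothVFieldOn X φ.source) (Y Z : VField M) :
    dFlat φ g X Y Z x = g x (nabla φ g Y X x) (Z x) - g x (nabla φ g Z X x) (Y x) := by
  have hs : ∀ i j, comp2 φ g i j = comp2 φ g j i := fun i j => funext fun y => hg.comp2_symm i j
  rw [hf.apply_nabla hg hφ hx, hf.apply_nabla hg hφ hx, dFlat,
    Finset.sum_comm (f := fun i m => dx φ i x (Z x) * dx φ m x (Y x) * covDerivLower φ g X i m x),
    ← Finset.sum_sub_distrib]
  refine Finset.sum_congr rfl fun i _ => ?_
  rw [← Finset.sum_sub_distrib]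
  refine Finset.sum_congr rfl fun j _ => ?_
  have : pd φ i (fun y => g y (X y) (coordVec φ j y)) x
      - pd φ j (fun y => g y (X y) (coordVec φ i y)) x =
      covDerivLower φ g X i j x - covDerivLower φ g X j i x := by
    rw [hf.pd_lower hg hφ hx hX, hf.pd_lower hg hφ hx hX, covDerivLower, covDerivLower,
      ← Finset.sum_sub_distrib, ← Finset.sum_sub_distrib]
    refine Finset.sum_congr rfl fun k _ => ?_
    rw [hs i k, hs j k, hs j i]
    ring
  rw [this]
  ring

/-- The Levi-Civita connection is compatible with the metric. -/
theorem IsAdaptedFrame.dirDeriv_apply (hf : IsAdaptedFrame g D φ.source s l a n)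
    (hg : IsLorentzMetric g) (hφ : IsChart φ) (hx : x ∈ φ.source) {X Y : VField M}
    (hX : SmoothVFieldOn X φ.source) (hY : SmoothVFieldOn Y φ.source) (Z : VField M) :
    dirDeriv Z (fun y => g y (X y) (Y y)) x =
      g x (nabla φ g Z X x) (Y x) + g x (nabla φ g Z Y x) (X x) := by
  have hs : ∀ i j, comp2 φ g i j = comp2 φ g j i := fun i j => funext fun y => hg.comp2_symm i j
  rw [hφ.dirDeriv_eq_sum hx, hf.apply_nabla hg hφ hx, hf.apply_nabla hg hφ hx,
    ← Finset.sum_add_distrib]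
  refine Finset.sum_congr rfl fun i _ => ?_
  have h1 : pd φ i (fun y => g y (X y) (Y y)) x = ∑ m,
      ((∑ k, (pd φ i (fun y => dx φ k y (X y)) x * comp2 φ g k m x
        + dx φ k x (X x) * pd φ i (comp2 φ g k m) x)) * dx φ m x (Y x)
        + (∑ k, dx φ k x (X x) * comp2 φ g k m x) * pd φ i (fun y => dx φ m y (Y y)) x) := by
    rw [pd_congr i hx fun y hy => hφ.apply_eq_sum_lower hy g (X y) (Y y), pd_sum _ i hx fun m =>
      (hg.smooth_lower hφ hX m).mul (hf.smooth_dx hg hφ hY m)]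
    refine Finset.sum_congr rfl fun m _ => ?_
    rw [pd_mul i hx (hg.smooth_lower hφ hX m) (hf.smooth_dx hg hφ hY m),
      hf.pd_lower hg hφ hx hX, hφ.apply_coordVec_eq_sum hx]
  rw [h1]
  simp only [covDerivLower, Fin.sum_univ_four, hs 1 0, hs 2 0, hs 3 0, hs 2 1, hs 3 1, hs 3 2]
  ring

theorem IsAdaptedFrame.nabla_add_nabla_eq_zero (hf : IsAdaptedFrame g D φ.source s l a n)
    (hg : IsLorentzMetric g) (hφ : IsChart φ) (hx : x ∈ φ.source) {X Y : VField M}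
    (hX : SmoothVFieldOn X φ.source) (hY : SmoothVFieldOn Y φ.source) (c : ℝ)
    (hc : ∀ y ∈ φ.source, g y (X y) (Y y) = c) (Z : VField M) :
    g x (nabla φ g Z X x) (Y x) + g x (nabla φ g Z Y x) (X x) = 0 := by
  rw [← hf.dirDeriv_apply hg hφ hx hX hY, dirDeriv_congr hx hc]
  simp [dirDeriv, mvfderiv_const]

end Connection

/-! ### Exterior derivatives of the frame covectors in terms of `∇l`. -/

section FrameConditions

variable {M : Type*} [TopologicalSpace M] [ChartedSpace E4 M] [IsManifold 𝓘(ℝ, E4) ∞ M]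
  {φ : OpenPartialHomeomorph M E4} {g : Tensor2 M} {D : PlaneField M} {s l a n : VField M} {x : M}

/-- The coefficient of `n` is `-g(v, l)` and that of `l` is `-g(v, n)`, because `l` and `n` are null
with product `-1`. -/
theorem IsAdaptedFrame.dx_expansion (hf : IsAdaptedFrame g D φ.source s l a n)
    (hg : IsLorentzMetric g) (hφ : IsChart φ) (hx : x ∈ φ.source) (i : Fin 4)
    (v : TangentSpace 𝓘(ℝ, E4) x) :
    dx φ i x v = g x v (s x) * dx φ i x (s x) + g x v (a x) * dx φ i x (a x)
      - g x v (l x) * dx φ i x (n x) - g x v (n x) * dx φ i x (l x) := by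
  rw [hf.dx_eq_sum_ginv hg hφ hx, hφ.apply_eq_sum_lower hx g v (s x),
    hφ.apply_eq_sum_lower hx g v (a x), hφ.apply_eq_sum_lower hx g v (l x),
    hφ.apply_eq_sum_lower hx g v (n x), Finset.sum_mul, Finset.sum_mul, Finset.sum_mul,
    Finset.sum_mul, ← Finset.sum_add_distrib, ← Finset.sum_sub_distrib, ← Finset.sum_sub_distrib]
  refine Finset.sum_congr rfl fun j _ => ?_
  rw [hf.ginv_eq hg hφ hx]
  ring

theorem IsAdaptedFrame.dx_l (hf : IsAdaptedFrame g D φ.source s l a n)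
    (hφ : IsAdaptedChart D φ) (hx : x ∈ φ.source) :
    dx φ 2 x (l x) = 0 ∧ dx φ 3 x (l x) = 0 := by
  rw [← hφ.2 x hx, hf.span x hx]
  exact Submodule.subset_span (by simp)

theorem IsAdaptedFrame.dx_s (hf : IsAdaptedFrame g D φ.source s l a n)
    (hφ : IsAdaptedChart D φ) (hx : x ∈ φ.source) :
    dx φ 2 x (s x) = 0 ∧ dx φ 3 x (s x) = 0 := by
  rw [← hφ.2 x hx, hf.span x hx]
  exact Submodule.subset_span (by simp)

theorem IsAdaptedFrame.apply_eq_zero_of_mem (hf : IsAdaptedFrame g D φ.source s l a n)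
    (hx : x ∈ φ.source) {u v : TangentSpace 𝓘(ℝ, E4) x} (hv : v ∈ D x)
    (hl : g x u (l x) = 0) (hs : g x u (s x) = 0) : g x u v = 0 := by
  rw [hf.span x hx, Submodule.mem_span_pair] at hv
  obtain ⟨b, c, rfl⟩ := hv
  simp [hl, hs]

theorem IsAdaptedFrame.l_lower (hf : IsAdaptedFrame g D φ.source s l a n)
    (hφ : IsAdaptedChart D φ) (hx : x ∈ φ.source) :
    g x (l x) (coordVec φ 0 x) = 0 ∧ g x (l x) (coordVec φ 1 x) = 0 :=
  ⟨hf.apply_eq_zero_of_mem hx (hφ.coordVec_mem hx).1 (hf.ll x hx) (hf.ls x hx),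
    hf.apply_eq_zero_of_mem hx (hφ.coordVec_mem hx).2 (hf.ll x hx) (hf.ls x hx)⟩

theorem IsAdaptedFrame.a_lower (hf : IsAdaptedFrame g D φ.source s l a n)
    (hg : IsLorentzMetric g) (hφ : IsAdaptedChart D φ) (hx : x ∈ φ.source) :
    g x (a x) (coordVec φ 0 x) = 0 ∧ g x (a x) (coordVec φ 1 x) = 0 := by
  have al := (hg.symm (a x) (l x)).trans (hf.la x hx)
  have as := (hg.symm (a x) (s x)).trans (hf.sa x hx)
  exact ⟨hf.apply_eq_zero_of_mem hx (hφ.coordVec_mem hx).1 al as,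
    hf.apply_eq_zero_of_mem hx (hφ.coordVec_mem hx).2 al as⟩

/-- `l` is orthogonal to the leaves, so `l♭` involves only `dx³` and `dx⁴`, and every term of `dl♭`
contains one of these covectors, which vanish on both `l` and `s`. -/
theorem IsAdaptedFrame.dFlat_l_l_s (hf : IsAdaptedFrame g D φ.source s l a n)
    (hφ : IsAdaptedChart D φ) (hx : x ∈ φ.source) : dFlat φ g l l s x = 0 := by
  have h0 : ∀ i, pd φ i (fun y => g y (l y) (coordVec φ 0 y)) x = 0 := fun i =>
    pd_eq_zero i 0 hx fun y hy => (hf.l_lower hφ hy).1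
  have h1 : ∀ i, pd φ i (fun y => g y (l y) (coordVec φ 1 y)) x = 0 := fun i =>
    pd_eq_zero i 0 hx fun y hy => (hf.l_lower hφ hy).2
  simp [dFlat, Fin.sum_univ_four, h0, h1, hf.dx_l hφ hx, hf.dx_s hφ hx]

/-- The products of `∇_l l` with `l` and `s` vanish always: the first since `g(l,l)` is constant,
the second since `dl♭(l,s) = 0` and `g(∇_s l, l) = 0`. Only the `a`-component can keep `∇_l l` from
being a multiple of `l`. -/
theorem IsAdaptedFrame.isPregeodesic_iff (hf : IsAdaptedFrame g D φ.source s l a n)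
    (hg : IsLorentzMetric g) (hφ : IsAdaptedChart D φ) :
    IsPregeodesic φ g l ↔ ∀ x ∈ φ.source, g x (nabla φ g l l x) (a x) = 0 := by
  constructor
  · rintro ⟨lam, h⟩ x hx
    simp [h x hx, hf.la x hx]
  · intro h
    -- The factor is the coefficient of `l` in the frame expansion of `∇_l l`.
    refine ⟨fun x => - g x (nabla φ g l l x) (n x), fun x hx => hφ.1.ext_dx hx fun i => ?_⟩
    have hll := fun Z => hf.nabla_add_nabla_eq_zero hg hφ.1 hx hf.smooth_l hf.smooth_l 0 hf.ll Z
    have hls : g x (nabla φ g l l x) (s x) = 0 := by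
      have h1 := hf.dFlat_eq hg hφ.1 hx hf.smooth_l l s
      rw [hf.dFlat_l_l_s hφ hx] at h1
      linarith [hll s]
    have hl0 : g x (nabla φ g l l x) (l x) = 0 := by linarith [hll l]
    rw [dx_smul, hf.dx_expansion hg hφ.1 hx, h x hx, hls, hl0]
    ring

/-- Constancy of the scalar products moves each derivative onto `l`: `dα(l,a) = g(∇_a l, a)`,
`ds♭(l,s) = g(∇_s l, s)` and `dl♭(l,a) = g(∇_l l, a)`. Equipartition says that the first two agree,
as `θ` is their mean. -/
theorem IsAdaptedFrame.frameCondition_iff (hf : IsAdaptedFrame g D φ.source s l a n)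
    (hg : IsLorentzMetric g) (hφ : IsAdaptedChart D φ) :
    FrameCondition φ g s l a ↔ IsPregeodesic φ g l ∧ HasEquipartition φ g s l a := by
  rw [hf.isPregeodesic_iff hg hφ, FrameCondition, HasEquipartition, ← forall₂_and]
  refine forall₂_congr fun x hx => ?_
  have hll := hf.nabla_add_nabla_eq_zero hg hφ.1 hx hf.smooth_l hf.smooth_l 0 hf.ll a
  have haa := hf.nabla_add_nabla_eq_zero hg hφ.1 hx hf.smooth_a hf.smooth_a 1 hf.aa l
  have hss := hf.nabla_add_nabla_eq_zero hg hφ.1 hx hf.smooth_s hf.smooth_s 1 hf.ss l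
  have hla := hf.nabla_add_nabla_eq_zero hg hφ.1 hx hf.smooth_l hf.smooth_a 0 hf.la a
  have hls := hf.nabla_add_nabla_eq_zero hg hφ.1 hx hf.smooth_l hf.smooth_s 0 hf.ls s
  rw [hf.dFlat_eq hg hφ.1 hx hf.smooth_a, hf.dFlat_eq hg hφ.1 hx hf.smooth_s,
    hf.dFlat_eq hg hφ.1 hx hf.smooth_l, nullMeanCurvature]
  constructor <;> rintro ⟨h1, h2⟩ <;> constructor <;> linarith

end FrameConditions

/-! ### The chart conditions in terms of the frame -/

section ChartConditions

variable {M : Type*} [TopologicalSpace M] [ChartedSpace E4 M] [IsManifold 𝓘(ℝ, E4) ∞ M]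
  {φ : OpenPartialHomeomorph M E4} {g : Tensor2 M} {D : PlaneField M} {s l a n : VField M} {x : M}

/-- `(dx³ ∧ dx⁴)(a, n)`. -/
noncomputable def transverseArea (φ : OpenPartialHomeomorph M E4) (a n : VField M) (x : M) : ℝ :=
  dx φ 2 x (a x) * dx φ 3 x (n x) - dx φ 3 x (a x) * dx φ 2 x (n x)

/-- `(dx¹ ∧ dx²)(l, s)`. -/
noncomputable def leafArea (φ : OpenPartialHomeomorph M E4) (s l : VField M) (x : M) : ℝ :=
  dx φ 0 x (l x) * dx φ 1 x (s x) - dx φ 1 x (l x) * dx φ 0 x (s x)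

/-- Both sides are `(α ∧ l♭)(a, n)`: it equals `1 · (-1) - 0 · 0` by the frame relations, and it
factors because `α` and `l♭` only involve `dx³` and `dx⁴`. In particular both factors are nonzero.
-/
theorem IsAdaptedFrame.kappa_inv_mul (hf : IsAdaptedFrame g D φ.source s l a n)
    (hg : IsLorentzMetric g) (hφ : IsAdaptedChart D φ) (hx : x ∈ φ.source) :
    (g x (a x) (coordVec φ 2 x) * g x (l x) (coordVec φ 3 x)
      - g x (a x) (coordVec φ 3 x) * g x (l x) (coordVec φ 2 x)) * transverseArea φ a n x = -1 := by
  have an := (hg.symm (a x) (n x)).trans (hf.na x hx)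
  have ln := (hg.symm (l x) (n x)).trans (hf.nl x hx)
  have aa := hf.aa x hx
  have la := hf.la x hx
  rw [hφ.1.apply_eq_sum_lower hx, Fin.sum_univ_four] at an ln aa la
  simp only [hf.l_lower hφ hx, hf.a_lower hg hφ hx, zero_mul, zero_add] at an ln aa la
  rw [transverseArea]
  linear_combination 
    (g x (l x) (coordVec φ 2 x) * dx φ 2 x (n x) + g x (l x) (coordVec φ 3 x) * dx φ 3 x (n x)) * aa
    + ln - (g x (a x) (coordVec φ 2 x) * dx φ 2 x (n x)
      + g x (a x) (coordVec φ 3 x) * dx φ 3 x (n x)) * la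

/-- Since `dx³` and `dx⁴` vanish on `s` and `l`, the frame matrix is block triangular. Its
determinant is, up to sign, the product of the two areas, and its square times `det g` is `-1`. -/
theorem IsAdaptedFrame.area_sq (hf : IsAdaptedFrame g D φ.source s l a n)
    (hg : IsLorentzMetric g) (hφ : IsAdaptedChart D φ) (hx : x ∈ φ.source) :
    (sqrtNegDet φ g x * transverseArea φ a n x * leafArea φ s l x) ^ 2 = 1 := by
  have h := hf.gram_det hg hφ.1 hx
  have hd : (frameMatrix φ s l a n x).det ^ 2
      = (transverseArea φ a n x * leafArea φ s l x) ^ 2 := by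
    rw [frameMatrix, transverseArea, leafArea]
    simp [Matrix.det_succ_row_zero, Fin.sum_univ_succ, Fin.succAbove, hf.dx_l hφ hx, hf.dx_s hφ hx]
    ring
  rw [mul_assoc, mul_pow, hf.sqrtNegDet_sq hg hφ.1 hx, ← hd]
  linarith

/-- Because `dx³` and `dx⁴` vanish on `s` and `l`, one has `g^{33} = a³a³`, `g^{34} = a³a⁴`, and
`g^{r3}`, `g^{r4}` reduce to `a^r a³ - l^r n³`, `a^r a⁴ - l^r n⁴`. The `a^r` terms cancel, so `M` is
a multiple of `l`. -/
theorem IsAdaptedFrame.Mvec_eq (hf : IsAdaptedFrame g D φ.source s l a n)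
    (hg : IsLorentzMetric g) (hφ : IsAdaptedChart D φ) (hx : x ∈ φ.source) (r : Fin 4) :
    Mvec φ g r x = transverseArea φ a n x * dx φ r x (l x) * dx φ 2 x (a x) := by
  simp only [Mvec, hf.ginv_eq hg hφ.1 hx, hf.dx_l hφ hx, hf.dx_s hφ hx, transverseArea]
  ring

theorem IsAdaptedFrame.Nvec_eq (hf : IsAdaptedFrame g D φ.source s l a n)
    (hg : IsLorentzMetric g) (hφ : IsAdaptedChart D φ) (hx : x ∈ φ.source) (r : Fin 4) :
    Nvec φ g r x = transverseArea φ a n x * dx φ r x (l x) * dx φ 3 x (a x) := by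
  simp only [Nvec, hf.ginv_eq hg hφ.1 hx, hf.dx_l hφ hx, hf.dx_s hφ hx, transverseArea]
  ring

theorem IsAdaptedFrame.smooth_transverseArea (hf : IsAdaptedFrame g D φ.source s l a n)
    (hg : IsLorentzMetric g) (hφ : IsChart φ) : SmoothFunOn (transverseArea φ a n) φ.source :=
  ((hf.smooth_dx hg hφ hf.smooth_a 2).mul (hf.smooth_dx hg hφ hf.smooth_n 3)).sub
    ((hf.smooth_dx hg hφ hf.smooth_a 3).mul (hf.smooth_dx hg hφ hf.smooth_n 2))

theorem IsAdaptedFrame.smooth_leafArea (hf : IsAdaptedFrame g D φ.source s l a n)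
    (hg : IsLorentzMetric g) (hφ : IsChart φ) : SmoothFunOn (leafArea φ s l) φ.source :=
  ((hf.smooth_dx hg hφ hf.smooth_l 0).mul (hf.smooth_dx hg hφ hf.smooth_s 1)).sub
    ((hf.smooth_dx hg hφ hf.smooth_l 1).mul (hf.smooth_dx hg hφ hf.smooth_s 0))

/-- The density `√(-g) (dx³ ∧ dx⁴)(a, n)`. -/
noncomputable def transverseDensity (φ : OpenPartialHomeomorph M E4) (g : Tensor2 M)
    (a n : VField M) (x : M) : ℝ :=
  sqrtNegDet φ g x * transverseArea φ a n x

theorem IsAdaptedFrame.smooth_transverseDensity (hf : IsAdaptedFrame g D φ.source s l a n)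
    (hg : IsLorentzMetric g) (hφ : IsChart φ) : SmoothFunOn (transverseDensity φ g a n) φ.source :=
  (hf.smooth_sqrtNegDet hg hφ).mul (hf.smooth_transverseArea hg hφ)

/-- The product squares to 1; differentiating the square avoids fixing the orientation of the frame.
-/
theorem IsAdaptedFrame.pd_density_mul_area (hf : IsAdaptedFrame g D φ.source s l a n)
    (hg : IsLorentzMetric g) (hφ : IsAdaptedChart D φ) (hx : x ∈ φ.source) (i : Fin 4) :
    pd φ i (fun y => transverseDensity φ g a n y * leafArea φ s l y) x = 0 := by
  have hc := (hf.smooth_transverseDensity hg hφ.1).mul (hf.smooth_leafArea hg hφ.1)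
  have h := pd_eq_zero i 1 hx
    (f := fun y => (transverseDensity φ g a n y * leafArea φ s l y) *
      (transverseDensity φ g a n y * leafArea φ s l y))
    fun y hy => by rw [← sq]; exact hf.area_sq hg hφ hy
  rw [pd_mul i hx hc hc] at h
  have h0 : transverseDensity φ g a n x * leafArea φ s l x ≠ 0 := fun h0 => by
    have := hf.area_sq hg hφ hx
    rw [← transverseDensity, h0] at this
    norm_num at this
  have := mul_left_cancel₀ h0 (b := pd φ i (fun y => transverseDensity φ g a n y *
    leafArea φ s l y) x) (c := 0) (by linarith)
  exact this

/-- Inside a leaf, `ds♭(l, s)` is a weighted divergence of `l`. -/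
theorem IsAdaptedFrame.density_mul_dFlat (hf : IsAdaptedFrame g D φ.source s l a n)
    (hg : IsLorentzMetric g) (hφ : IsAdaptedChart D φ) (hx : x ∈ φ.source) :
    transverseDensity φ g a n x * dFlat φ g s l s x =
      pd φ 0 (fun y => transverseDensity φ g a n y * dx φ 0 y (l y)) x
      + pd φ 1 (fun y => transverseDensity φ g a n y * dx φ 1 y (l y)) x := by
  have hc := (hf.smooth_transverseDensity hg hφ.1).mul (hf.smooth_leafArea hg hφ.1)
  -- On the leaf, `s♭` is determined by `s♭(l) = 0` and `s♭(s) = 1`; Cramer's rule gives its two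
  -- components. They turn the density times `l` into a locally constant multiple of the components
  -- of `s♭`.
  have low : ∀ y ∈ φ.source,
      g y (s y) (coordVec φ 0 y) * leafArea φ s l y = - dx φ 1 y (l y) ∧
      g y (s y) (coordVec φ 1 y) * leafArea φ s l y = dx φ 0 y (l y) := by
    intro y hy
    have ss := hf.ss y hy
    have sl := (hg.symm (s y) (l y)).trans (hf.ls y hy)
    rw [hφ.1.apply_eq_sum_lower hy, Fin.sum_univ_four] at ss sl
    simp only [hf.dx_l hφ hy, hf.dx_s hφ hy, mul_zero, add_zero] at ss sl
    rw [leafArea]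
    constructor
    · linear_combination dx φ 1 y (s y) * sl - dx φ 1 y (l y) * ss
    · linear_combination dx φ 0 y (l y) * ss - dx φ 0 y (s y) * sl
  have p1 : pd φ 1 (fun y => transverseDensity φ g a n y * dx φ 1 y (l y)) x =
      - (transverseDensity φ g a n x * leafArea φ s l x *
        pd φ 1 (fun y => g y (s y) (coordVec φ 0 y)) x) := by
    have e : ∀ y ∈ φ.source, transverseDensity φ g a n y * dx φ 1 y (l y) =
        (-1) * ((transverseDensity φ g a n y * leafArea φ s l y) * g y (s y) (coordVec φ 0 y)) := by
      intro y hy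
      linear_combination transverseDensity φ g a n y * (low y hy).1
    rw [pd_congr 1 hx e, pd_const_mul 1 _ hx (hc.mul (hg.smooth_lower hφ.1 hf.smooth_s 0)),
      pd_mul 1 hx hc (hg.smooth_lower hφ.1 hf.smooth_s 0), hf.pd_density_mul_area hg hφ hx]
    ring
  have p0 : pd φ 0 (fun y => transverseDensity φ g a n y * dx φ 0 y (l y)) x =
      transverseDensity φ g a n x * leafArea φ s l x *
        pd φ 0 (fun y => g y (s y) (coordVec φ 1 y)) x := by
    have e : ∀ y ∈ φ.source, transverseDensity φ g a n y * dx φ 0 y (l y) =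
        (transverseDensity φ g a n y * leafArea φ s l y) * g y (s y) (coordVec φ 1 y) := by
      intro y hy
      linear_combination -transverseDensity φ g a n y * (low y hy).2
    rw [pd_congr 0 hx e, pd_mul 0 hx hc (hg.smooth_lower hφ.1 hf.smooth_s 1), hf.pd_density_mul_area hg hφ hx]
    ring
  rw [p0, p1]
  simp only [dFlat, Fin.sum_univ_four, hf.dx_l hφ hx, hf.dx_s hφ hx, leafArea]
  ring

/-- The divergence of `f κ l` for a function `f`, up to sign. -/
theorem IsAdaptedFrame.divg_eq (hf : IsAdaptedFrame g D φ.source s l a n)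
    (hg : IsLorentzMetric g) (hφ : IsAdaptedChart D φ) (hx : x ∈ φ.source)
    {V : Fin 4 → M → ℝ} {f : M → ℝ} (hfs : SmoothFunOn f φ.source)
    (hV : ∀ y ∈ φ.source, ∀ r, V r y = transverseArea φ a n y * dx φ r y (l y) * f y) :
    divg φ g V x = transverseArea φ a n x * (f x * dFlat φ g s l s x
      + (dx φ 0 x (l x) * pd φ 0 f x + dx φ 1 x (l x) * pd φ 1 f x)) := by
  have hp : ∀ r, pd φ r (fun y => sqrtNegDet φ g y * V r y) x =
      pd φ r (fun y => transverseDensity φ g a n y * dx φ r y (l y)) x * f x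
        + transverseDensity φ g a n x * dx φ r x (l x) * pd φ r f x := by
    intro r
    rw [pd_congr r hx (h := fun y => (transverseDensity φ g a n y * dx φ r y (l y)) * f y)
      fun y hy => by rw [hV y hy, transverseDensity]; ring]
    rw [pd_mul r hx ((hf.smooth_transverseDensity hg hφ.1).mul
      (hf.smooth_dx hg hφ.1 hf.smooth_l r)) hfs]
  have z2 : pd φ 2 (fun y => transverseDensity φ g a n y * dx φ 2 y (l y)) x = 0 :=
    pd_eq_zero 2 0 hx fun y hy => by rw [(hf.dx_l hφ hy).1, mul_zero]
  have z3 : pd φ 3 (fun y => transverseDensity φ g a n y * dx φ 3 y (l y)) x = 0 :=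
    pd_eq_zero 3 0 hx fun y hy => by rw [(hf.dx_l hφ hy).2, mul_zero]
  have hsq := (hf.sqrtNegDet_pos hg hφ.1 hx).ne'
  have hd := hf.density_mul_dFlat hg hφ hx
  simp only [divg, hp, Fin.sum_univ_four, z2, z3, hf.dx_l hφ hx]
  rw [one_div, inv_mul_eq_iff_eq_mul₀ hsq]
  rw [transverseDensity] at hd ⊢
  linear_combination -f x * hd

/-- As `X♭` has only `dx³` and `dx⁴` components, `dX♭(l,a) = l(X₃)a³ + l(X₄)a⁴`. Differentiating the
constant `X₃a³ + X₄a⁴` moves the derivatives onto the components of `a`. This is used for `X = a`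
and `X = l`. -/
theorem IsAdaptedFrame.dFlat_l_a (hf : IsAdaptedFrame g D φ.source s l a n)
    (hg : IsLorentzMetric g) (hφ : IsAdaptedChart D φ) (hx : x ∈ φ.source) {X : VField M}
    (hX : SmoothVFieldOn X φ.source) (c : ℝ) (hc : ∀ y ∈ φ.source, g y (X y) (a y) = c)
    (h0 : ∀ y ∈ φ.source, g y (X y) (coordVec φ 0 y) = 0 ∧ g y (X y) (coordVec φ 1 y) = 0) :
    dFlat φ g X l a x = -(g x (X x) (coordVec φ 2 x) * (dx φ 0 x (l x) *
        pd φ 0 (fun y => dx φ 2 y (a y)) x + dx φ 1 x (l x) * pd φ 1 (fun y => dx φ 2 y (a y)) x)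
      + g x (X x) (coordVec φ 3 x) * (dx φ 0 x (l x) *
        pd φ 0 (fun y => dx φ 3 y (a y)) x
          + dx φ 1 x (l x) * pd φ 1 (fun y => dx φ 3 y (a y)) x)) := by
  have e : ∀ i, pd φ i (fun y => g y (X y) (coordVec φ 2 y)) x * dx φ 2 x (a x)
      + g x (X x) (coordVec φ 2 x) * pd φ i (fun y => dx φ 2 y (a y)) x
      + (pd φ i (fun y => g y (X y) (coordVec φ 3 y)) x * dx φ 3 x (a x)
      + g x (X x) (coordVec φ 3 x) * pd φ i (fun y => dx φ 3 y (a y)) x) = 0 := by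
    intro i
    have h2 := hg.smooth_lower hφ.1 hX 2
    have h3 := hg.smooth_lower hφ.1 hX 3
    have k2 := hf.smooth_dx hg hφ.1 hf.smooth_a 2
    have k3 := hf.smooth_dx hg hφ.1 hf.smooth_a 3
    rw [← pd_mul i hx h2 k2, ← pd_mul i hx h3 k3, ← pd_add i hx (h2.mul k2) (h3.mul k3)]
    refine pd_eq_zero i c hx fun y hy => ?_
    rw [← hc y hy, hφ.1.apply_eq_sum_lower hy g (X y) (a y), Fin.sum_univ_four, (h0 y hy).1, (h0 y hy).2]
    ring
  have z0 : ∀ i, pd φ i (fun y => g y (X y) (coordVec φ 0 y)) x = 0 := fun i =>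
    pd_eq_zero i 0 hx fun y hy => (h0 y hy).1
  have z1 : ∀ i, pd φ i (fun y => g y (X y) (coordVec φ 1 y)) x = 0 := fun i =>
    pd_eq_zero i 0 hx fun y hy => (h0 y hy).2
  simp only [dFlat, Fin.sum_univ_four, hf.dx_l hφ hx, z0, z1]
  linear_combination dx φ 0 x (l x) * e 0 + dx φ 1 x (l x) * e 1

/-- After division by the nonzero transverse area, the two divergences are related to the two frame
conditions by the matrix with rows `(α₃, α₄)` and `(l₃, l₄)`. -/
theorem IsAdaptedFrame.chartCondition_iff (hf : IsAdaptedFrame g D φ.source s l a n)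
    (hg : IsLorentzMetric g) (hφ : IsAdaptedChart D φ) :
    ChartCondition φ g ↔ FrameCondition φ g s l a := by
  refine forall₂_congr fun x hx => ?_
  have hk := hf.kappa_inv_mul hg hφ hx
  have ht : transverseArea φ a n x ≠ 0 := fun h => by simp [h] at hk
  have hk0 : (g x (a x) (coordVec φ 2 x) * g x (l x) (coordVec φ 3 x)
      - g x (a x) (coordVec φ 3 x) * g x (l x) (coordVec φ 2 x)) ≠ 0 := fun h => by simp [h] at hk
  have aa := hf.aa x hx
  have la := hf.la x hx
  rw [hφ.1.apply_eq_sum_lower hx, Fin.sum_univ_four] at aa la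
  simp only [hf.l_lower hφ hx, hf.a_lower hg hφ hx, zero_mul, zero_add] at aa la
  rw [hf.divg_eq hg hφ hx (hf.smooth_dx hg hφ.1 hf.smooth_a 2) fun y hy => hf.Mvec_eq hg hφ hy,
    hf.divg_eq hg hφ hx (hf.smooth_dx hg hφ.1 hf.smooth_a 3) fun y hy => hf.Nvec_eq hg hφ hy,
    hf.dFlat_l_a hg hφ hx hf.smooth_a 1 hf.aa fun y hy => hf.a_lower hg hφ hy,
    hf.dFlat_l_a hg hφ hx hf.smooth_l 0 hf.la fun y hy => hf.l_lower hφ hy,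
    mul_eq_zero_iff_left ht, mul_eq_zero_iff_left ht]
  generalize dFlat φ g s l s x = d
  generalize dx φ 0 x (l x) * pd φ 0 (fun y => dx φ 2 y (a y)) x +
    dx φ 1 x (l x) * pd φ 1 (fun y => dx φ 2 y (a y)) x = u
  generalize dx φ 0 x (l x) * pd φ 0 (fun y => dx φ 3 y (a y)) x +
    dx φ 1 x (l x) * pd φ 1 (fun y => dx φ 3 y (a y)) x = v
  constructor
  · rintro ⟨h1, h2⟩
    constructor
    · linear_combination d * aa - g x (a x) (coordVec φ 2 x) * h1 - g x (a x) (coordVec φ 3 x) * h2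
    · linear_combination d * la - g x (l x) (coordVec φ 2 x) * h1 - g x (l x) (coordVec φ 3 x) * h2
  · rintro ⟨h1, h2⟩
    -- Cramer's rule, with the nonzero determinant `κ⁻¹`.
    constructor <;> refine mul_left_cancel₀ hk0 ?_ <;> rw [mul_zero]
    · linear_combination g x (l x) (coordVec φ 3 x) * (d * aa - h1)
        - g x (a x) (coordVec φ 3 x) * (d * la - h2)
    · linear_combination g x (a x) (coordVec φ 2 x) * (d * la - h2)
        - g x (l x) (coordVec φ 2 x) * (d * aa - h1)

end ChartConditions

/-! ### Contractions of the alternating symbol. -/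

/-- Over `ℤ` the determinant is decidable, which allows a check of all index values. -/
theorem eps_eq_cast (a b c d : Fin 4) :
    eps a b c d = ((Matrix.det (Matrix.of fun i j : Fin 4 =>
      if ![a, b, c, d] i = j then (1 : ℤ) else 0) : ℤ) : ℝ) := by
  rw [eps, Int.cast_det]
  congr 1
  ext i j
  simp [apply_ite (Int.cast : ℤ → ℝ)]

/-- The alternating symbol as a Vandermonde product. -/
theorem eps_eq (a b c d : Fin 4) :
    eps a b c d = (((b : ℕ) - a) * ((c : ℕ) - a) * ((d : ℕ) - a) * ((c : ℕ) - b) *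
      ((d : ℕ) - b) * ((d : ℕ) - c) / 12 : ℝ) := by
  -- The constant 12 is the Vandermonde product of `0, 1, 2, 3`.
  have h : ∀ a b c d : Fin 4, 12 * Matrix.det (Matrix.of fun i j : Fin 4 =>
      if ![a, b, c, d] i = j then (1 : ℤ) else 0) =
      ((b : ℕ) - a) * ((c : ℕ) - a) * ((d : ℕ) - a) * ((c : ℕ) - b) *
      ((d : ℕ) - b) * ((d : ℕ) - c) := by
    intro a b c d
    simp only [Matrix.det_succ_row_zero, Fin.sum_univ_succ, Matrix.submatrix_apply, Matrix.of_apply,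
      Fin.succAbove]
    revert a b c d
    decide +kernel
  rw [eps_eq_cast, eq_div_iff (by norm_num), mul_comm]
  exact_mod_cast h a b c d

theorem sum_eps_mul (u v w z : Fin 4 → ℝ) :
    ∑ a, ∑ b, ∑ c, ∑ d, eps a b c d * (u a * v b * w c * z d)
      = Matrix.det (Matrix.of ![u, v, w, z]) := by
  simp only [Fin.sum_univ_four, eps_eq]
  norm_num
  simp [Matrix.det_succ_row_zero, Fin.sum_univ_succ, Fin.succAbove]
  ring

theorem sum_eps_mul_of_isSymm {G : Matrix (Fin 4) (Fin 4) ℝ} (hG : G.IsSymm)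
    (p q r e : Fin 4) :
    ∑ a, ∑ b, ∑ c, ∑ d, eps a b c d * (G a p * G b q * G c r * G e d) = G.det * eps p q r e := by
  rw [sum_eps_mul (fun a => G a p) (fun b => G b q) (fun c => G c r) (fun d => G e d), eps,
    mul_comm, ← Matrix.det_mul]
  congr 1
  ext i j
  have h : ∀ q, G q j = ∑ k, (if q = k then (1 : ℝ) else 0) * G k j := by simp
  rw [Matrix.mul_apply]
  fin_cases i
  · exact (hG.apply p j).trans (h p)
  · exact (hG.apply q j).trans (h q)
  · exact (hG.apply r j).trans (h r)
  · exact h e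

theorem sum_comm_three {ι κ : Type*} [Fintype ι] [Fintype κ] (f : ι → κ → κ → κ → ℝ) :
    ∑ i, ∑ p, ∑ q, ∑ r, f i p q r = ∑ p, ∑ q, ∑ r, ∑ i, f i p q r := by
  rw [Finset.sum_comm]
  refine Finset.sum_congr rfl fun p _ => ?_
  rw [Finset.sum_comm]
  refine Finset.sum_congr rfl fun q _ => ?_
  rw [Finset.sum_comm]

/-- Raising the free index of the dual of a 3-form supplies the fourth factor `G`, and four factors
`G` contracted with `ε` give `det G · ε`. No inverse metric is left except in the determinant. -/
theorem sum_mul_sum_eps_of_isSymm {G : Matrix (Fin 4) (Fin 4) ℝ} (hG : G.IsSymm) (k : ℝ)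
    (J : Fin 4 → Fin 4 → Fin 4 → ℝ) (e : Fin 4) :
    ∑ d, G e d * ((1 / 6) * ∑ a, ∑ b, ∑ c, k * eps a b c d *
      ∑ p, ∑ q, ∑ r, G a p * G b q * G c r * J p q r) =
      (1 / 6) * k * G.det * ∑ p, ∑ q, ∑ r, eps p q r e * J p q r := by
  have h1 : ∀ p q r, (1 / 6) * k * G.det * (eps p q r e * J p q r) =
      ∑ a, ∑ b, ∑ c, ∑ d, G e d * ((1 / 6) * (k * eps a b c d * (G a p * G b q * G c r *
        J p q r))) := by
    intro p q r
    rw [show (1 / 6) * k * G.det * (eps p q r e * J p q r) =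
      (1 / 6) * k * J p q r * (G.det * eps p q r e) by ring, ← sum_eps_mul_of_isSymm hG]
    simp only [Finset.mul_sum]
    refine Finset.sum_congr rfl fun a _ => Finset.sum_congr rfl fun b _ =>
      Finset.sum_congr rfl fun c _ => Finset.sum_congr rfl fun d _ => by ring
  simp only [Finset.mul_sum, h1]
  rw [sum_comm_three]
  refine (Finset.sum_congr rfl fun a _ => Finset.sum_congr rfl fun b _ =>
    Finset.sum_congr rfl fun c _ => sum_comm_three _).trans ?_
  refine (Finset.sum_congr rfl fun a _ => Finset.sum_congr rfl fun b _ =>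
    sum_comm_three _).trans ?_
  exact (Finset.sum_congr rfl fun a _ => sum_comm_three _).trans (sum_comm_three _)

/-- This is the algebra of `*d*`, with `Q k a b` standing for `∂ₖ(√(-g) F^{ab})`: contracting the
two alternating symbols leaves only the trace, that is, the divergence. -/
theorem sum_eps_mul_cyclic_sum_eps (Q : Fin 4 → Fin 4 → Fin 4 → ℝ)
    (hQ : ∀ k a b, Q k a b = - Q k b a) (e : Fin 4) :
    ∑ p, ∑ q, ∑ r, eps p q r e * ((1 / 2) * ∑ a, ∑ b, eps a b q r * Q p a b
      + (1 / 2) * ∑ a, ∑ b, eps a b r p * Q q a b + (1 / 2) * ∑ a, ∑ b, eps a b p q * Q r a b)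
      = 6 * ∑ k, Q k k e := by
  have h0 : ∀ k a, Q k a a = 0 := fun k a => by linarith [hQ k a a]
  have h1 : ∀ k c d, (1 / 2) * ∑ a, ∑ b, eps a b c d * Q k a b =
      eps 0 1 c d * Q k 0 1 + eps 0 2 c d * Q k 0 2 + eps 0 3 c d * Q k 0 3
      + eps 1 2 c d * Q k 1 2 + eps 1 3 c d * Q k 1 3 + eps 2 3 c d * Q k 2 3 := by
    intro k c d
    simp only [Fin.sum_univ_four, h0, hQ k 1 0, hQ k 2 0, hQ k 3 0, hQ k 2 1, hQ k 3 1, hQ k 3 2,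
      eps_eq]
    norm_num
    ring
  simp only [h1]
  obtain rfl | rfl | rfl | rfl := (by decide : ∀ e : Fin 4, e = 0 ∨ e = 1 ∨ e = 2 ∨ e = 3) e <;>
  · simp only [Fin.sum_univ_four, eps_eq]
    norm_num [h0]
    try simp only [hQ _ 1 0, hQ _ 2 0, hQ _ 3 0, hQ _ 2 1, hQ _ 3 1, hQ _ 3 2]
    ring

/-! ### The current as a divergence. -/

section Current

variable {M : Type*} [TopologicalSpace M] [ChartedSpace E4 M]
  {φ : OpenPartialHomeomorph M E4} {g : Tensor2 M} {x : M}

theorem IsTwoFormOn.comp2_antisymm {F : Tensor2 M} (hF : IsTwoFormOn φ F) (hx : x ∈ φ.source)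
    (i j : Fin 4) : comp2 φ F i j x = - comp2 φ F j i x := by
  have h := hF.2 x hx (coordVec φ i x + coordVec φ j x)
  simp only [map_add, add_apply, hF.2 x hx] at h
  simp only [comp2]
  linarith

/-- The components `F^{ab}` of a 2-tensor with raised indices. -/
noncomputable def raise (φ : OpenPartialHomeomorph M E4) (g : Tensor2 M) (F : Tensor2 M)
    (a b : Fin 4) (x : M) : ℝ :=
  ∑ a', ∑ b', ginv φ g a a' x * ginv φ g b b' x * comp2 φ F a' b' x

theorem IsTwoFormOn.raise_antisymm {F : Tensor2 M} (hF : IsTwoFormOn φ F) (hx : x ∈ φ.source)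
    (i j : Fin 4) : raise φ g F i j x = - raise φ g F j i x := by
  rw [raise, raise, Finset.sum_comm, ← Finset.sum_neg_distrib]
  refine Finset.sum_congr rfl fun p _ => ?_
  rw [← Finset.sum_neg_distrib]
  refine Finset.sum_congr rfl fun q _ => ?_
  rw [hF.comp2_antisymm hx q p]
  ring

variable [IsManifold 𝓘(ℝ, E4) ∞ M] {D : PlaneField M} {s l a n : VField M}

theorem IsAdaptedFrame.smooth_raise (hf : IsAdaptedFrame g D φ.source s l a n)
    (hg : IsLorentzMetric g) (hφ : IsChart φ) {F : Tensor2 M} (hF : IsTwoFormOn φ F)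
    (i j : Fin 4) : SmoothFunOn (raise φ g F i j) φ.source :=
  SmoothFunOn.sum _ fun p _ => SmoothFunOn.sum _ fun q _ =>
    ((hf.smooth_ginv hg hφ i p).mul (hf.smooth_ginv hg hφ j q)).mul (hF.1 p q)

theorem IsLorentzMetric.gram_isSymm (hg : IsLorentzMetric g) : (gram φ g x).IsSymm :=
  Matrix.IsSymm.ext fun _ _ => hg.comp2_symm _ _

theorem IsAdaptedFrame.pd_hodge2 (hf : IsAdaptedFrame g D φ.source s l a n)
    (hg : IsLorentzMetric g) (hφ : IsChart φ) (hx : x ∈ φ.source) {F : Tensor2 M}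
    (hF : IsTwoFormOn φ F) (k c d : Fin 4) :
    pd φ k (hodge2 φ g (comp2 φ F) c d) x = (1 / 2) * ∑ p, ∑ q, eps p q c d *
      pd φ k (fun y => sqrtNegDet φ g y * raise φ g F p q y) x := by
  have hs : ∀ p q, SmoothFunOn (fun y => sqrtNegDet φ g y * raise φ g F p q y) φ.source :=
    fun p q => (hf.smooth_sqrtNegDet hg hφ).mul (hf.smooth_raise hg hφ hF p q)
  have hs' : ∀ p q, SmoothFunOn (fun y => eps p q c d *
      (sqrtNegDet φ g y * raise φ g F p q y)) φ.source :=
    fun p q => (smoothFunOn_const _).mul (hs p q)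
  have e : ∀ y ∈ φ.source, hodge2 φ g (comp2 φ F) c d y = (1 / 2) * ∑ p, ∑ q, eps p q c d *
      (sqrtNegDet φ g y * raise φ g F p q y) := by
    intro y _
    rw [hodge2]
    congr 1
    refine Finset.sum_congr rfl fun p _ => Finset.sum_congr rfl fun q _ => ?_
    rw [raise]
    ring
  rw [pd_congr k hx e, pd_const_mul k _ hx (SmoothFunOn.sum _ fun p _ =>
    SmoothFunOn.sum _ fun q _ => hs' p q), pd_sum _ k hx fun p => SmoothFunOn.sum _ fun q _ =>
    hs' p q]
  congr 1
  refine Finset.sum_congr rfl fun p _ => ?_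
  rw [pd_sum _ k hx fun q => hs' p q]
  exact Finset.sum_congr rfl fun q _ => pd_const_mul k _ hx (hs p q)

/-- The current `* d * F` is the divergence of `F`, up to sign. -/
theorem IsAdaptedFrame.currentSharp_eq (hf : IsAdaptedFrame g D φ.source s l a n)
    (hg : IsLorentzMetric g) (hφ : IsChart φ) (hx : x ∈ φ.source) {F : Tensor2 M}
    (hF : IsTwoFormOn φ F) (e : Fin 4) :
    currentSharp φ g F e x = - divg φ g (fun r => raise φ g F r e) x := by
  -- The Lorentzian sign of this determinant is the minus sign in the result; the remaining power of
  -- `√(-g)` is the prefactor of the divergence.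
  have hdet : (gram φ g x)⁻¹.det = - (sqrtNegDet φ g x ^ 2)⁻¹ := by
    rw [hf.sqrtNegDet_sq hg hφ hx, Matrix.det_nonsing_inv, Ring.inverse_eq_inv', inv_neg, neg_neg]
  have hsym : ((gram φ g x)⁻¹).IsSymm := by
    rw [Matrix.IsSymm, Matrix.transpose_nonsing_inv, hg.gram_isSymm.eq]
  have hsq := (hf.sqrtNegDet_pos hg hφ hx).ne'
  have h := sum_mul_sum_eps_of_isSymm hsym (sqrtNegDet φ g x)
    (fun p q r => extDeriv2 φ (hodge2 φ g (comp2 φ F)) p q r x) e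
  have h2 : ∑ p, ∑ q, ∑ r, eps p q r e * extDeriv2 φ (hodge2 φ g (comp2 φ F)) p q r x =
      6 * ∑ k, pd φ k (fun y => sqrtNegDet φ g y * raise φ g F k e y) x := by
    simp only [extDeriv2, hf.pd_hodge2 hg hφ hx hF]
    refine sum_eps_mul_cyclic_sum_eps (fun k p q =>
      pd φ k (fun y => sqrtNegDet φ g y * raise φ g F p q y) x) (fun k p q => ?_) e
    have hs := (hf.smooth_sqrtNegDet hg hφ).mul (hf.smooth_raise hg hφ hF q p)
    have ee : ∀ y ∈ φ.source, sqrtNegDet φ g y * raise φ g F p q y =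
        (-1) * (sqrtNegDet φ g y * raise φ g F q p y) := by
      intro y hy
      rw [hF.raise_antisymm hy p q]
      ring
    rw [pd_congr k hx ee, pd_const_mul k _ hx hs, neg_one_mul]
  rw [currentSharp]
  refine h.trans ?_
  rw [h2, hdet, divg]
  field_simp

end Current

/-! ### Null force-free fields with kernel tangent to the foliation. -/

section Solutions

variable {M : Type*} [TopologicalSpace M] [ChartedSpace E4 M]
  {φ : OpenPartialHomeomorph M E4} {g F : Tensor2 M} {D : PlaneField M} {u : M → ℝ} {x : M}

theorem HasChartForm.comp2_eq (h : HasChartForm φ u F) (hφ : IsChart φ) (hx : x ∈ φ.source)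
    (i j : Fin 4) : comp2 φ F i j x = ((if 2 = i then 1 else 0) * (if 3 = j then 1 else 0)
      - (if 2 = j then 1 else 0) * (if 3 = i then 1 else 0)) * u x := by
  rw [comp2, h x hx]
  simp only [hφ.dx_coordVec hx]
  ring

/-- The kernel contains `∂₁` and `∂₂`, so by antisymmetry only one independent component of `F`
survives. -/
theorem hasChartForm_of_kernelIs (hφ : IsAdaptedChart D φ) (hF : IsTwoFormOn φ F)
    (hk : KernelIs F D φ.source) : HasChartForm φ (comp2 φ F 2 3) F := by
  intro x hx v w
  have h0 := (hk x hx _).1 (hφ.coordVec_mem hx).1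
  have h1 := (hk x hx _).1 (hφ.coordVec_mem hx).2
  have k0 : ∀ j, comp2 φ F 0 j x = 0 := fun j => h0 _
  have k1 : ∀ j, comp2 φ F 1 j x = 0 := fun j => h1 _
  have an := hF.comp2_antisymm hx
  have d := fun i => (show comp2 φ F i i x = 0 from hF.2 x hx _)
  rw [hφ.1.apply_eq_sum hx]
  simp only [Fin.sum_univ_four, k0, k1, d, an 2 0, an 2 1, an 3 0, an 3 1, an 3 2]
  ring

theorem KernelIs.comp2_ne_zero (hφ : IsAdaptedChart D φ) (hF : IsTwoFormOn φ F)
    (hk : KernelIs F D φ.source) (hx : x ∈ φ.source) : comp2 φ F 2 3 x ≠ 0 := by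
  intro h
  have h2 : coordVec φ 2 x ∈ D x := by
    rw [hk x hx]
    intro w
    rw [hasChartForm_of_kernelIs hφ hF hk x hx, h, zero_mul]
  have := ((hφ.2 x hx _).1 h2).1
  simp [hφ.1.dx_coordVec hx] at this

theorem HasChartForm.kernelIs (h : HasChartForm φ u F) (hφ : IsAdaptedChart D φ)
    (hu : ∀ x ∈ φ.source, u x ≠ 0) : KernelIs F D φ.source := by
  intro x hx v
  rw [hφ.2 x hx]
  constructor
  · rintro ⟨h2, h3⟩ w
    rw [h x hx, h2, h3]
    ring
  · intro hw
    have h2 := hw (coordVec φ 3 x)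
    have h3 := hw (coordVec φ 2 x)
    rw [h x hx] at h2 h3
    simp [hφ.1.dx_coordVec hx, hu x hx] at h2 h3
    exact ⟨h2, h3⟩

/-- `dF = du ∧ dx³ ∧ dx⁴`, which only sees the derivatives of `u` along the leaf. -/
theorem HasChartForm.closed_iff (h : HasChartForm φ u F) (hφ : IsChart φ)
    (hu : SmoothFunOn u φ.source) (hx : x ∈ φ.source) :
    (∀ a b c, extDeriv2 φ (comp2 φ F) a b c x = 0) ↔ pd φ 0 u x = 0 ∧ pd φ 1 u x = 0 := by
  have hp : ∀ k i j, pd φ k (comp2 φ F i j) x =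
      ((if 2 = i then 1 else 0) * (if 3 = j then 1 else 0)
      - (if 2 = j then 1 else 0) * (if 3 = i then 1 else 0)) * pd φ k u x := fun k i j => by
    rw [pd_congr k hx fun y hy => h.comp2_eq hφ hy i j, pd_const_mul k _ hx hu]
  simp only [extDeriv2, hp]
  constructor
  · intro h
    have h0 := h 0 2 3
    have h1 := h 1 2 3
    simp at h0 h1
    exact ⟨h0, h1⟩
  · rintro ⟨h0, h1⟩ a b c
    fin_cases a <;> fin_cases b <;> fin_cases c <;> simp [h0, h1]

/-- The 2-form `dx³ ∧ dx⁴` of a chart. -/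
noncomputable def chartForm (φ : OpenPartialHomeomorph M E4) : Tensor2 M := fun x =>
  ((EuclideanSpace.proj 2 : E4 →L[ℝ] ℝ).comp (mvfderiv 𝓘(ℝ, E4) φ x)).smulRight
    ((EuclideanSpace.proj 3 : E4 →L[ℝ] ℝ).comp (mvfderiv 𝓘(ℝ, E4) φ x)) -
  ((EuclideanSpace.proj 3 : E4 →L[ℝ] ℝ).comp (mvfderiv 𝓘(ℝ, E4) φ x)).smulRight
    ((EuclideanSpace.proj 2 : E4 →L[ℝ] ℝ).comp (mvfderiv 𝓘(ℝ, E4) φ x))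

theorem hasChartForm_chartForm : HasChartForm φ (fun _ => 1) (chartForm φ) := by
  intro x _ v w
  simp [chartForm, dx]
  ring

theorem isTwoFormOn_chartForm (hφ : IsChart φ) : IsTwoFormOn φ (chartForm φ) := by
  refine ⟨fun i j => ?_, fun x hx v => ?_⟩
  · exact (smoothFunOn_const _).congr fun y hy => hasChartForm_chartForm.comp2_eq hφ hy i j
  · rw [hasChartForm_chartForm x hx]
    ring

theorem isAdmissible_one : IsAdmissible φ (fun _ => 1) :=
  ⟨smoothFunOn_const 1, fun _ _ => by simp⟩

variable [IsManifold 𝓘(ℝ, E4) ∞ M] {s l a n : VField M}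

/-- Raising both indices of `u dx³ ∧ dx⁴` gives `F^{r3} = u M^r` and `F^{r4} = u N^r`; this is where
`M` and `N` come from. -/
theorem IsAdaptedFrame.raise_eq (hf : IsAdaptedFrame g D φ.source s l a n)
    (hg : IsLorentzMetric g) (hφ : IsAdaptedChart D φ) (h : HasChartForm φ u F)
    (hx : x ∈ φ.source) (r : Fin 4) :
    raise φ g F r 2 x = transverseArea φ a n x * dx φ r x (l x) * (u x * dx φ 2 x (a x)) ∧
    raise φ g F r 3 x = transverseArea φ a n x * dx φ r x (l x) * (u x * dx φ 3 x (a x)) := by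
  have hs : ginv φ g 3 2 x = ginv φ g 2 3 x := by
    rw [hf.ginv_eq hg hφ.1 hx, hf.ginv_eq hg hφ.1 hx]
    ring
  have hM := hf.Mvec_eq hg hφ hx r
  have hN := hf.Nvec_eq hg hφ hx r
  rw [Mvec] at hM
  rw [Nvec] at hN
  simp only [raise, Fin.sum_univ_four, h.comp2_eq hφ.1 hx, hs]
  simp only [Fin.reduceEq, if_true, if_false]
  constructor
  · linear_combination u x * hM
  · linear_combination u x * hN

/-- Nullity is free: `F^{34}` is proportional to a transverse component of `l`. Once closedness
makes `u` constant along `l`, it factors out of the divergence, so `j³ = -u ∇_rM^r` and `j⁴ = -u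
∇_rN^r`. As `u ≠ 0`, `i_{j♯}F = 0` says exactly that these two components vanish. -/
theorem IsAdaptedFrame.isNullForceFree_iff (hf : IsAdaptedFrame g D φ.source s l a n)
    (hg : IsLorentzMetric g) (hφ : IsAdaptedChart D φ) (hF : IsTwoFormOn φ F)
    (h : HasChartForm φ u F) (hu : SmoothFunOn u φ.source) (hu0 : ∀ x ∈ φ.source, u x ≠ 0) :
    IsNullForceFree φ g F ↔
      (∀ x ∈ φ.source, pd φ 0 u x = 0 ∧ pd φ 1 u x = 0) ∧ ChartCondition φ g := by
  have hnull : ∀ x ∈ φ.source, ∑ a, ∑ b, comp2 φ F a b x *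
      (∑ a', ∑ b', ginv φ g a a' x * ginv φ g b b' x * comp2 φ F a' b' x) = 0 := by
    intro x hx
    change ∑ a, ∑ b, comp2 φ F a b x * raise φ g F a b x = 0
    have h1 := (hf.raise_eq hg hφ h hx 3).1
    have h2 := (hf.raise_eq hg hφ h hx 2).2
    rw [(hf.dx_l hφ hx).2] at h1
    rw [(hf.dx_l hφ hx).1] at h2
    simp only [h.comp2_eq hφ.1 hx, Fin.sum_univ_four, h1, h2, Fin.reduceEq, if_true, if_false]
    ring
  have hff : ∀ x ∈ φ.source, (pd φ 0 u x = 0 ∧ pd φ 1 u x = 0) →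
      ((∀ b, ∑ a, currentSharp φ g F a x * comp2 φ F a b x = 0) ↔
        divg φ g (Mvec φ g) x = 0 ∧ divg φ g (Nvec φ g) x = 0) := by
    rintro x hx ⟨p0, p1⟩
    have k2 := hf.smooth_dx hg hφ.1 hf.smooth_a 2
    have k3 := hf.smooth_dx hg hφ.1 hf.smooth_a 3
    have c2 : currentSharp φ g F 2 x = - (u x * divg φ g (Mvec φ g) x) := by
      rw [hf.currentSharp_eq hg hφ.1 hx hF, hf.divg_eq hg hφ hx (hu.mul k2)
        fun y hy r => (hf.raise_eq hg hφ h hy r).1,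
        hf.divg_eq hg hφ hx k2 fun y hy => hf.Mvec_eq hg hφ hy,
        pd_mul 0 hx hu k2, pd_mul 1 hx hu k2, p0, p1]
      ring
    have c3 : currentSharp φ g F 3 x = - (u x * divg φ g (Nvec φ g) x) := by
      rw [hf.currentSharp_eq hg hφ.1 hx hF, hf.divg_eq hg hφ hx (hu.mul k3)
        fun y hy r => (hf.raise_eq hg hφ h hy r).2,
        hf.divg_eq hg hφ hx k3 fun y hy => hf.Nvec_eq hg hφ hy,
        pd_mul 0 hx hu k3, pd_mul 1 hx hu k3, p0, p1]
      ring
    simp only [h.comp2_eq hφ.1 hx, Fin.sum_univ_four, c2, c3, Fin.reduceEq, if_true, if_false]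
    constructor
    · intro hb
      have b2 := hb 2
      have b3 := hb 3
      simp [hu0 x hx] at b2 b3
      exact ⟨b3, b2⟩
    · rintro ⟨m, n⟩ b
      rw [m, n]
      ring
  constructor
  · intro hN
    have hp := fun x hx => (h.closed_iff hφ.1 hu hx).1 (hN.closed x hx)
    exact ⟨hp, fun x hx => (hff x hx (hp x hx)).1 (hN.forceFree x hx)⟩
  · rintro ⟨hp, hc⟩
    exact ⟨hF, fun x hx => (h.closed_iff hφ.1 hu hx).2 (hp x hx),
      fun x hx => (hff x hx (hp x hx)).2 (hc x hx), hnull⟩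

theorem IsAdaptedFrame.chartSolutionClass_iff (hf : IsAdaptedFrame g D φ.source s l a n)
    (hg : IsLorentzMetric g) (hφ : IsAdaptedChart D φ) :
    ChartSolutionClass φ g D ↔ ChartCondition φ g := by
  constructor
  · intro hS
    -- The single solution `u = 1` already forces the chart condition.
    have hN := ((hS _ (isTwoFormOn_chartForm hφ.1)).2
      ⟨_, isAdmissible_one, hasChartForm_chartForm⟩).1
    exact ((hf.isNullForceFree_iff hg hφ (isTwoFormOn_chartForm hφ.1) hasChartForm_chartForm
      (smoothFunOn_const 1) fun _ _ => one_ne_zero).1 hN).2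
  · intro hC F hF
    constructor
    · rintro ⟨hN, hk⟩
      have h := hasChartForm_of_kernelIs hφ hF hk
      have h0 := fun x hx => KernelIs.comp2_ne_zero (x := x) hφ hF hk hx
      have hp := ((hf.isNullForceFree_iff hg hφ hF h (hF.1 2 3) h0).1 hN).1
      exact ⟨_, ⟨hF.1 2 3, fun x hx => ⟨h0 x hx, hp x hx⟩⟩, h⟩
    · rintro ⟨u, ⟨hu, hu'⟩, h⟩
      exact ⟨(hf.isNullForceFree_iff hg hφ hF h hu fun x hx => (hu' x hx).1).2
        ⟨fun x hx => (hu' x hx).2, hC⟩, h.kernelIs hφ fun x hx => (hu' x hx).1⟩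

/-- `α` and `l♭` annihilate the leaves, so `α ∧ l♭ = κ⁻¹ dx³ ∧ dx⁴`, and `κ` is exactly the
normalizing factor. -/
theorem IsAdaptedFrame.hasFrameForm_iff (hf : IsAdaptedFrame g D φ.source s l a n)
    (hg : IsLorentzMetric g) (hφ : IsAdaptedChart D φ) :
    HasFrameForm φ g l a u F ↔ HasChartForm φ u F := by
  refine forall₂_congr fun x hx => forall₂_congr fun v w => ?_
  have hk0 : (g x (a x) (coordVec φ 2 x) * g x (l x) (coordVec φ 3 x)
      - g x (a x) (coordVec φ 3 x) * g x (l x) (coordVec φ 2 x)) ≠ 0 := fun h => by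
    simpa [h] using hf.kappa_inv_mul hg hφ hx
  have key : kappa φ g l a x * (g x (a x) v * g x (l x) w - g x (a x) w * g x (l x) v) =
      dx φ 2 x v * dx φ 3 x w - dx φ 2 x w * dx φ 3 x v := by
    rw [kappa, inv_mul_eq_iff_eq_mul₀ hk0, hφ.1.apply_eq_sum_lower hx g (a x) v,
      hφ.1.apply_eq_sum_lower hx g (a x) w, hφ.1.apply_eq_sum_lower hx g (l x) v,
      hφ.1.apply_eq_sum_lower hx g (l x) w]
    simp only [Fin.sum_univ_four, hf.l_lower hφ hx, hf.a_lower hg hφ hx]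
    ring
  rw [mul_assoc, key]

theorem IsAdaptedFrame.frameSolutionClass_iff (hf : IsAdaptedFrame g D φ.source s l a n)
    (hg : IsLorentzMetric g) (hφ : IsAdaptedChart D φ) :
    FrameSolutionClass φ g D l a ↔ ChartSolutionClass φ g D := by
  simp only [FrameSolutionClass, ChartSolutionClass, hf.hasFrameForm_iff hg hφ]

end Solutions

end NullFFE

theorem mainTheorem7 {M : Type*} [TopologicalSpace M] [ChartedSpace NullFFE.E4 M]
    [IsManifold 𝓘(ℝ, NullFFE.E4) ∞ M]
    (g : NullFFE.Tensor2 M) (hg : NullFFE.IsLorentzMetric g)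
    (D : NullFFE.PlaneField M) (hD : NullFFE.IsNullFoliation g D)
    (φ : OpenPartialHomeomorph M NullFFE.E4) (hφ : NullFFE.IsAdaptedChart D φ)
    (s l a n : NullFFE.VField M) (hframe : NullFFE.IsAdaptedFrame g D φ.source s l a n) :
    List.TFAE [
      NullFFE.ChartCondition φ g,
      NullFFE.FrameCondition φ g s l a,
      NullFFE.IsPregeodesic φ g l ∧ NullFFE.HasEquipartition φ g s l a,
      NullFFE.ChartSolutionClass φ g D,
      NullFFE.FrameSolutionClass φ g D l a] := by
  tfae_have 1 ↔ 2 := hframe.chartCondition_iff hg hφ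
  tfae_have 2 ↔ 3 := hframe.frameCondition_iff hg hφ
  tfae_have 4 ↔ 1 := hframe.chartSolutionClass_iff hg hφ
  tfae_have 5 ↔ 4 := hframe.frameSolutionClass_iff hg hφ
  tfae_finish
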